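/- Let $r\ge 2$ be an integer and arrange the $2r+1$ elements of $J=[2r+1]$ in order on a circle. Identify $S\subseteq J$ with its cyclic $0/1$ indicator sequence. Let $\mathbf u(S)=(u_1,u_2,\ldots)$ be the sequence of the lengths of the maximal runs of consecutive $1$'s, in non-increasing order with multiplicity, and let $\mathbf z(S)=(z_1,z_2,\ldots)$ be the analogous sequence for the maximal runs of consecutive $0$'s (if $S=J$ there is a single run of $1$'s, of length $2r+1$, and no run of $0$'s; similarly for $S=\emptyset$). Let $\mathcal F_r\subseteq 2^{J}$ be the family of all $S\subseteq J$ for which $\mathbf u(S)$ is lexicographically larger than $\mathbf z(S)$, where a proper prefix counts as smaller. For $i\in J$ let $$I_i(\mathcal F_r)=2^{-(2r+1)}\cdot\big|\{S\subseteq J:\ \text{exactly one of } S,\ S\,\Delta\,\{i\}\text{ belongs to }\mathcal F_r\}\big|$$ be the influence of the coordinate $i$ with respect to the uniform measure on $2^{J}$. Then $I_i(\mathcal F_r)=O\big(\frac{\log r}{r}\big)$ as $r\to\infty$, uniformly in $i$: there is an absolute constant $C$ such that $I_i(\mathcal F_r)\le C\,\frac{\log_2 r}{r}$ for all $r\ge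 2$ and all $i\in J$. -/

import Mathlib

open Finset
open scoped symmDiff

namespace CyclicRuns

section Biased

variable {α : Type*} [Fintype α] [DecidableEq α]

/-- The `p`-biased weight `p ^ |F| * (1 - p) ^ (n - |F|)` of a subset `F` of an `n`-element
ground set. -/
def biasedWeight (p : ℝ) (F : Finset α) : ℝ :=
  p ^ F.card * (1 - p) ^ (Fintype.card α - F.card)

/-- The `p`-biased measure of a family of sets. -/
def biasedMeasure (p : ℝ) (𝓕 : Finset (Finset α)) : ℝ :=
  ∑ F ∈ 𝓕, biasedWeight p F

/-- The influence of the coordinate `i` in the family `𝓕`: the `p`-biased measure of the family of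
all `F` such that exactly one of `F` and `F ∆ {i}` belongs to `𝓕`. -/
def influence (p : ℝ) (𝓕 : Finset (Finset α)) (i : α) : ℝ :=
  biasedMeasure p
    (univ.filter fun F : Finset α => (({F, F ∆ {i}} : Finset (Finset α)) ∩ 𝓕).card = 1)

end Biased

/-- The arc `{a, a + 1, …, a + (ℓ - 1)}` on the circle formed by the `2 * r + 1` elements of
`Fin (2 * r + 1)`, whose addition is modulo `2 * r + 1`. -/
def arc {r : ℕ} (a : Fin (2 * r + 1)) (ℓ : ℕ) : Finset (Fin (2 * r + 1)) :=
  (range ℓ).image fun j => a + Fin.ofNat (2 * r + 1) j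

/-- `A` is a run of `S`: an inclusion-maximal nonempty arc contained in `S`. -/
def IsRun {r : ℕ} (S A : Finset (Fin (2 * r + 1))) : Prop :=
  Maximal (fun B => B.Nonempty ∧ B ⊆ S ∧ ∃ a ℓ, B = arc a ℓ) A

open Classical in
/-- The finite set of all runs of `S`. -/
noncomputable def runs {r : ℕ} (S : Finset (Fin (2 * r + 1))) :
    Finset (Finset (Fin (2 * r + 1))) :=
  univ.filter (IsRun S)

/-- The lengths of the runs of `S`, with multiplicity, in non-increasing order. -/
noncomputable def runLengths {r : ℕ} (S : Finset (Fin (2 * r + 1))) : List ℕ :=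
  ((runs S).val.map Finset.card).sort (· ≥ ·)

/-- The family of all `S` whose sequence of lengths of runs of ones (runs of `S`) is
lexicographically larger than its sequence of lengths of runs of zeros (runs of `Sᶜ`). -/
noncomputable def family (r : ℕ) : Finset (Finset (Fin (2 * r + 1))) :=
  univ.filter fun S => runLengths Sᶜ < runLengths S

end CyclicRuns

namespace CyclicRuns

set_option linter.unusedSectionVars false

/-! Put n = 2r+1. The lexicographic comparison is decided by the largest length at which ones and
zeros have different numbers of runs. Suppose toggling i changes the outcome, and let ℓ be the
largest length at which some multiplicity changes. Above ℓ each of the two words has equally many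
runs of ones and of zeros, since a difference there would decide both comparisons alike. Apart from
constant words, i belongs to or delimits a run of length ℓ in one of the two words
(`exists_count_change`, `critical_of_mem_family_ne`).

A run of length a at i has probability O(a 2^{-a}). A tie at level L should have probability of
order (2^L/n)^{1/2}, because there are about n 2^{-L} runs of that length. Requiring ties at only
the three levels a+1, a+2, a+3 gives a 2^{a/2} n^{-3/2}, whose sum over a < log₂ n is O(log n / n).
With two levels the sum would not be geometric and a factor log n would be lost. A run of length at
least log₂ n at i has probability O(log n / n) by itself (`sum_critical_le`).

The ties need enough independent randomness, even jointly and given the run at i. It comes from the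
gadgets 1 0 b⋯b 1 0. Complementing the middle letters turns a run of L ones into a run of L zeros or
back, and otherwise affects only runs of length 1. Gadgets meet only in their ends, so the flips do
not interfere. Given the number k of gadgets of level L and all that flips preserve, the number with
b = 1 is binomial, and a tie prescribes its value. Hence a tie costs at most the central binomial
probability (`sum_tied_le`), and flip invariance lets three levels be treated in turn
(`sum_tied_three_le`). By Cauchy–Schwarz it remains to bound a joint inverse moment of the three
gadget counts. This is done by planting gadgets at many positions (`card_mul_sum_div_sites_le`). -/

/-- The cyclic word `x` reads `p 0, p 1, …, p (w - 1)` from the position `s` on. -/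
def Matches {n : ℕ} (p : ℕ → Bool) (w : ℕ) (x : ZMod n → Bool) (s : ZMod n) : Prop :=
  ∀ j < w, x (s + j) = p j

/-- The word `1 0 b ⋯ b 1 0` with `L - 1` letters `b`. -/
def gadget (b : Bool) (L j : ℕ) : Bool :=
  if j = 0 then true else if j = 1 then false else if j ≤ L then b else decide (j = L + 1)

/-- A run of `ℓ` letters `c` together with the two letters that delimit it. -/
def runPattern (c : Bool) (ℓ j : ℕ) : Bool :=
  if j = 0 ∨ j = ℓ + 1 then !c else c

/-- The cyclic word `x` with the `w` letters from `s` on replaced by `p`. -/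
def overwrite {n : ℕ} (p : ℕ → Bool) (w : ℕ) (s : ZMod n) (x : ZMod n → Bool) : ZMod n → Bool :=
  fun t => if (t - s).val < w then p (t - s).val else x t

/-- The cyclic word `x` with the letters at `s + 2, …, s + L` complemented. -/
def flipAt {n : ℕ} (L : ℕ) (s : ZMod n) (x : ZMod n → Bool) : ZMod n → Bool :=
  fun t => if 2 ≤ (t - s).val ∧ (t - s).val ≤ L then !x t else x t

open Classical in
/-- The starting positions of the gadgets of level `L` with middle letter `b`. -/
noncomputable def gadgetSites {n : ℕ} [NeZero n] (b : Bool) (L : ℕ) (x : ZMod n → Bool) :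
    Finset (ZMod n) :=
  univ.filter (Matches (gadget b L) (L + 3) x)

/-- The starting positions of the gadgets of level `L`. -/
noncomputable def sites {n : ℕ} [NeZero n] (L : ℕ) (x : ZMod n → Bool) : Finset (ZMod n) :=
  gadgetSites true L x ∪ gadgetSites false L x

open Classical in
/-- The positions that precede a run of `ℓ` letters `c`. -/
noncomputable def runSites {n : ℕ} [NeZero n] (c : Bool) (ℓ : ℕ) (x : ZMod n → Bool) :
    Finset (ZMod n) :=
  univ.filter (Matches (runPattern c ℓ) (ℓ + 2) x)

/-! ### Overwriting windows of cyclic words; overlaps of gadgets -/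

section Words

variable {n : ℕ} [NeZero n]

lemma val_natCast_sub (s : ZMod n) {j : ℕ} (hj : j < n) : (s + (j : ZMod n) - s).val = j := by
  rw [add_sub_cancel_left, ZMod.val_natCast, Nat.mod_eq_of_lt hj]

lemma eq_add_val (s t : ZMod n) : t = s + (((t - s).val : ℕ) : ZMod n) := by
  rw [ZMod.natCast_zmod_val]; ring

lemma mem_gadgetSites {b : Bool} {L : ℕ} {x : ZMod n → Bool} {s : ZMod n} :
    s ∈ gadgetSites b L x ↔ Matches (gadget b L) (L + 3) x s := by
  simp [gadgetSites]

lemma mem_runSites {c : Bool} {L : ℕ} {x : ZMod n → Bool} {s : ZMod n} :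
    s ∈ runSites c L x ↔ Matches (runPattern c L) (L + 2) x s := by
  simp [runSites]

lemma mem_sites {L : ℕ} {x : ZMod n → Bool} {s : ZMod n} :
    s ∈ sites L x ↔ ∃ b, Matches (gadget b L) (L + 3) x s := by
  simp [sites, mem_gadgetSites, or_comm]

lemma matches_overwrite {p : ℕ → Bool} {w : ℕ} (hw : w ≤ n) (s : ZMod n) (x : ZMod n → Bool) :
    Matches p w (overwrite p w s x) s := by
  intro j hj
  simp [overwrite, ZMod.val_natCast, Nat.mod_eq_of_lt (hj.trans_le hw), hj]

lemma card_overwrite_fiber {p : ℕ → Bool} {w : ℕ} (hw : w ≤ n) {s : ZMod n}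
    {y : ZMod n → Bool} (h : Matches p w y s) :
    (univ.filter fun x : ZMod n → Bool => overwrite p w s x = y).card = 2 ^ w := by
  have : (univ.filter fun x : ZMod n → Bool => overwrite p w s x = y)
      = Fintype.piFinset fun t : ZMod n => if (t - s).val < w then univ else {y t} := by
    ext x
    simp only [mem_filter, mem_univ, true_and, Fintype.mem_piFinset]
    constructor
    · rintro rfl t
      by_cases ht : (t - s).val < w <;> simp [ht, overwrite]
    · intro hx
      funext t
      have := hx t
      by_cases ht : (t - s).val < w
      · simp only [overwrite, ht, if_true]
        rw [← h _ ht, ← eq_add_val]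
      · simpa [ht, overwrite] using this
  rw [this, Fintype.card_piFinset]
  have h2 : ∀ t : ZMod n, (if (t - s).val < w then (univ : Finset Bool) else {y t}).card
      = if (t - s).val < w then 2 else 1 := by
    intro t; split_ifs <;> simp
  simp only [h2]
  rw [prod_ite]
  simp only [prod_const, one_pow, mul_one]
  congr 1
  have : (univ.filter fun t : ZMod n => (t - s).val < w)
      = (range w).image fun j : ℕ => s + (j : ZMod n) := by
    ext t
    simp only [mem_filter, mem_univ, true_and, mem_image, mem_range]
    constructor
    · intro ht; exact ⟨_, ht, (eq_add_val s t).symm⟩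
    · rintro ⟨j, hj, rfl⟩
      rwa [val_natCast_sub s (hj.trans_le hw)]
  rw [this, card_image_of_injOn, card_range]
  intro i hi j hj hij
  simp only [coe_range, Set.mem_Iio] at hi hj
  rw [← val_natCast_sub s (hi.trans_le hw), ← val_natCast_sub s (hj.trans_le hw)]
  simp only at hij
  rw [hij]

open Classical in
-- `overwrite` is 2^w-to-one onto the words that match: the overwritten letters are free, the others
-- are determined. This converts planting a pattern into restricting to its occurrence.
lemma sum_overwrite {p : ℕ → Bool} {w : ℕ} (hw : w ≤ n) (s : ZMod n)
    (g : (ZMod n → Bool) → ℝ) :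
    ∑ x, g (overwrite p w s x) = 2 ^ w * ∑ x, if Matches p w x s then g x else 0 := by
  rw [← Finset.sum_fiberwise_of_maps_to (s := univ) (t := univ.filter fun x => Matches p w x s)
    (g := overwrite p w s) (fun x _ => by simp [matches_overwrite hw]), ← sum_filter, mul_sum]
  refine sum_congr rfl fun y hy => ?_
  rw [sum_congr rfl (g := fun _ => g y) (fun x hx => by rw [(mem_filter.1 hx).2]), sum_const,
    card_overwrite_fiber hw (mem_filter.1 hy).2]
  simp

open Classical in
lemma sum_matches {p : ℕ → Bool} {w : ℕ} (hw : w ≤ n) (s : ZMod n) :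
    2 ^ w * (∑ x : ZMod n → Bool, if Matches p w x s then (1 : ℝ) else 0) = 2 ^ n := by
  rw [← sum_overwrite hw s]
  simp [ZMod.card]

/-- Gadgets do not contain the word `10` except at their two ends. -/
lemma no_descent {b : Bool} {L : ℕ} {x : ZMod n → Bool} {s : ZMod n}
    (h : Matches (gadget b L) (L + 3) x s) {k : ℕ} (h1 : 1 ≤ k) (hk : k ≤ L)
    (hx : x (s + k) = true) (hx' : x (s + k + 1) = false) : False := by
  have e1 := h k (by omega)
  have e2 := h (k + 1) (by omega)
  push_cast at e2
  rw [← add_assoc, hx'] at e2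
  rw [hx] at e1
  unfold gadget at e1 e2
  split_ifs at e1 e2 <;> first | omega | (simp_all <;> omega)

lemma matches_gadget_descent {b : Bool} {L : ℕ} (hL : 1 ≤ L) {x : ZMod n → Bool} {s : ZMod n}
    (h : Matches (gadget b L) (L + 3) x s) : x s = true ∧ x (s + 1) = false ∧
      x (s + (L + 1 : ℕ)) = true ∧ x (s + (L + 1 : ℕ) + 1) = false := by
  refine ⟨by simpa [gadget] using h 0 (by omega), by simpa [gadget] using h 1 (by omega), ?_, ?_⟩
  · have := h (L + 1) (by omega)
    rw [this]
    unfold gadget; split_ifs <;> first | omega | simp_all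
  · have := h (L + 2) (by omega)
    have e : s + ((L + 1 : ℕ) : ZMod n) + 1 = s + ((L + 2 : ℕ) : ZMod n) := by push_cast; ring
    rw [e, this]
    unfold gadget; split_ifs <;> first | omega | simp_all

/-- Two gadgets can only meet in their ends. -/
lemma gadgets_meet {b b' : Bool} {L L' : ℕ} {x : ZMod n → Bool} {s t : ZMod n}
    (h : Matches (gadget b L) (L + 3) x s) (h' : Matches (gadget b' L') (L' + 3) x t)
    {j k : ℕ} (hj : j ≤ L' + 2) (hk2 : 2 ≤ k) (hk : k ≤ L) (hL' : 1 ≤ L')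
    (e : t + (j : ZMod n) = s + (k : ZMod n)) : s = t ∧ L = L' ∧ j = k := by
  obtain ⟨a1, a2, a3, a4⟩ := matches_gadget_descent (by omega) h
  obtain ⟨b1, b2, b3, b4⟩ := matches_gadget_descent (by omega) h'
  -- With different offsets, the initial 10 of one gadget would lie strictly between the two ends of
  -- the other.
  have hjk : j = k := by
    rcases lt_trichotomy j k with hlt | heq | hgt
    · exfalso
      have : t = s + ((k - j : ℕ) : ZMod n) := by
        rw [Nat.cast_sub hlt.le]; linear_combination e
      rw [this] at b1 b2
      exact no_descent h (by omega) (by omega) b1 b2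
    · exact heq
    · exfalso
      have : s = t + ((j - k : ℕ) : ZMod n) := by
        rw [Nat.cast_sub hgt.le]; linear_combination -e
      rw [this] at a1 a2
      exact no_descent h' (by omega) (by omega) a1 a2
  subst hjk
  have hst : t = s := by linear_combination e
  subst hst
  refine ⟨rfl, ?_, rfl⟩
  -- The gadgets start together, so the closing 10 of a shorter one would lie inside the longer one.
  rcases lt_trichotomy L L' with hlt | heq | hgt
  · exact (no_descent h' (by omega) (by omega) a3 a4).elim
  · exact heq
  · exact (no_descent h (by omega) (by omega) b3 b4).elim

/-- Starting positions of gadgets of one level are more than L apart, which bounds how many fit near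
a window. -/
lemma gadget_sep {b b' : Bool} {L : ℕ} {x : ZMod n → Bool} {s : ZMod n}
    (h : Matches (gadget b L) (L + 3) x s) {d : ℕ} (h1 : 1 ≤ d) (hd : d ≤ L)
    (h' : Matches (gadget b' L) (L + 3) x (s + d)) : False := by
  obtain ⟨b1, b2, -, -⟩ := matches_gadget_descent (by omega) h'
  exact no_descent h h1 hd b1 b2

end Words

/-! ### Effect of a flip on runs and gadgets -/

section Flip

variable {n : ℕ} [NeZero n]

lemma flipAt_flipAt (L : ℕ) (s : ZMod n) (x : ZMod n → Bool) :
    flipAt L s (flipAt L s x) = x := by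
  funext t
  unfold flipAt
  split_ifs <;> simp

lemma matches_flipAt_iff {p : ℕ → Bool} {w L : ℕ} {s t : ZMod n} {x : ZMod n → Bool}
    (h : ∀ j < w, ∀ k, 2 ≤ k → k ≤ L → t + (j : ZMod n) ≠ s + (k : ZMod n)) :
    Matches p w (flipAt L s x) t ↔ Matches p w x t := by
  have : ∀ j < w, flipAt L s x (t + j) = x (t + j) := by
    intro j hj
    unfold flipAt
    rw [if_neg]
    rintro ⟨h2, hL⟩
    exact h j hj _ h2 hL (eq_add_val s (t + j))
  unfold Matches
  exact forall₂_congr fun j hj => by rw [this j hj]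

lemma matches_flipAt_self {b : Bool} {L : ℕ} (hL : L + 3 ≤ n) {s : ZMod n} {x : ZMod n → Bool}
    (h : Matches (gadget b L) (L + 3) x s) :
    Matches (gadget (!b) L) (L + 3) (flipAt L s x) s := by
  intro j hj
  have := h j hj
  rw [flipAt, val_natCast_sub s (by omega), this]
  unfold gadget
  split_ifs <;> first | omega | rfl

/-- The possible relative positions of a run and a gadget that overlaps it. -/
lemma runPattern_meets_gadget {b c : Bool} {ℓ L j k : ℕ} (hℓ : 2 ≤ ℓ) (hj : j ≤ ℓ + 1)
    (hk2 : 2 ≤ k) (hk : k ≤ L)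
    (H : ∀ i m, i ≤ ℓ + 1 → m ≤ L + 2 → i + k = m + j → runPattern c ℓ i = gadget b L m) :
    ℓ = L ∧ b = c ∧ k = j + (if b then 1 else 0) := by
  have r0 : runPattern c ℓ 0 = !c := by simp [runPattern]
  have r1 : ∀ i, 1 ≤ i → i ≤ ℓ → runPattern c ℓ i = c := by
    intro i h1 h2; unfold runPattern; rw [if_neg]; omega
  have r2 : runPattern c ℓ (ℓ + 1) = !c := by simp [runPattern]
  have g0 : gadget b L 0 = true := by simp [gadget]
  have g1 : gadget b L 1 = false := by simp [gadget]
  have g2 : ∀ i, 2 ≤ i → i ≤ L → gadget b L i = b := by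
    intro i h1 h2; unfold gadget; rw [if_neg (by omega), if_neg (by omega), if_pos h2]
  have g3 : gadget b L (L + 1) = true := by
    unfold gadget; rw [if_neg (by omega), if_neg (by omega), if_neg (by omega)]; simp
  have g4 : gadget b L (L + 2) = false := by
    unfold gadget; rw [if_neg (by omega), if_neg (by omega), if_neg (by omega)]; simp
  -- Equal letters: both runs are maximal and share a position, so they coincide. The gadget's run
  -- occupies the indices 2, …, L + 1 if b = 1 and 1, …, L if b = 0, whence the shift by one.
  by_cases hbc : b = c
  · subst hbc
    have hj0 : j ≠ 0 := by
      rintro rfl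
      have := H 0 k (by omega) (by omega) (by omega)
      rw [r0, g2 k hk2 hk] at this; simp at this
    have hj1 : j ≠ ℓ + 1 := by
      rintro rfl
      have := H (ℓ + 1) k (by omega) (by omega) (by omega)
      rw [r2, g2 k hk2 hk] at this; simp at this
    cases b
    · have hjk : j = k := by
        rcases lt_trichotomy j k with h | h | h
        · have := H 0 (k - j) (by omega) (by omega) (by omega)
          rw [r0] at this
          by_cases h1 : k - j = 1
          · rw [h1, g1] at this; simp at this
          · rw [g2 _ (by omega) (by omega)] at this; simp at this
        · exact h
        · have := H (j - k) 0 (by omega) (by omega) (by omega)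
          rw [g0, r1 _ (by omega) (by omega)] at this; simp at this
      subst hjk
      refine ⟨?_, rfl, by simp⟩
      rcases lt_trichotomy ℓ L with h | h | h
      · have := H (ℓ + 1) (ℓ + 1) (by omega) (by omega) (by omega)
        rw [r2, g2 _ (by omega) (by omega)] at this; simp at this
      · exact h
      · have := H (L + 1) (L + 1) (by omega) (by omega) (by omega)
        rw [g3, r1 _ (by omega) (by omega)] at this; simp at this
    · have hjk : k = j + 1 := by
        rcases lt_trichotomy k (j + 1) with h | h | h
        · have := H (j + 1 - k) 1 (by omega) (by omega) (by omega)
          rw [g1, r1 _ (by omega) (by omega)] at this; simp at this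
        · exact h
        · have := H 0 (k - j) (by omega) (by omega) (by omega)
          rw [r0, g2 _ (by omega) (by omega)] at this; simp at this
      subst hjk
      refine ⟨?_, rfl, by simp⟩
      rcases lt_trichotomy ℓ L with h | h | h
      · have := H (ℓ + 1) (ℓ + 2) (by omega) (by omega) (by omega)
        rw [r2] at this
        by_cases h1 : ℓ + 1 = L
        · subst h1; rw [g3] at this; simp at this
        · rw [g2 _ (by omega) (by omega)] at this; simp at this
      · exact h
      · have := H (L + 1) (L + 2) (by omega) (by omega) (by omega)
        rw [g4, r1 _ (by omega) (by omega)] at this; simp at this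
  · exfalso
    -- Different letters: only a delimiter of the run could lie in the flipped block. Either the
    -- letter next to it is still b, or the adjacent run of the other letter has length 1 inside the
    -- gadget, against `2 ≤ ℓ`.
    have hcb : c ≠ b := fun h => hbc h.symm
    by_cases hj0 : j = 0
    · subst hj0
      by_cases hkL : k = L
      · subst hkL
        cases b
        · have := H 2 (k + 2) (by omega) (by omega) (by omega)
          rw [g4, r1 _ (by omega) (by omega)] at this; exact hcb this
        · have := H 1 (k + 1) (by omega) (by omega) (by omega)
          rw [g3, r1 _ (by omega) (by omega)] at this; exact hcb this
      · have := H 1 (k + 1) (by omega) (by omega) (by omega)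
        rw [r1 _ (by omega) (by omega), g2 _ (by omega) (by omega)] at this; exact hcb this
    by_cases hj1 : j = ℓ + 1
    · subst hj1
      by_cases hk3 : k = 2
      · subst hk3
        cases b
        · have := H ℓ 1 (by omega) (by omega) (by omega)
          rw [g1, r1 _ (by omega) (by omega)] at this; exact hcb this
        · have := H (ℓ - 1) 0 (by omega) (by omega) (by omega)
          rw [g0, r1 _ (by omega) (by omega)] at this; exact hcb this
      · have := H ℓ (k - 1) (by omega) (by omega) (by omega)
        rw [r1 _ (by omega) (by omega), g2 _ (by omega) (by omega)] at this; exact hcb this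
    have := H j k (by omega) (by omega) (by omega)
    rw [r1 _ (by omega) (by omega), g2 _ (by omega) (by omega)] at this; exact hcb this

/-- The position that precedes the run of `L` letters in a gadget at `s` with middle letter `b`. -/
def gadgetRun {n : ℕ} (b : Bool) (s : ZMod n) : ZMod n := s + if b then 1 else 0

lemma run_meets_gadget {b c : Bool} {ℓ L : ℕ} {x : ZMod n → Bool} {s t : ZMod n}
    (hℓ : 2 ≤ ℓ) (h : Matches (gadget b L) (L + 3) x s)
    (h' : Matches (runPattern c ℓ) (ℓ + 2) x t) {j k : ℕ} (hj : j < ℓ + 2) (hk2 : 2 ≤ k)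
    (hk : k ≤ L) (e : t + (j : ZMod n) = s + (k : ZMod n)) :
    ℓ = L ∧ b = c ∧ t = gadgetRun b s := by
  obtain ⟨h1, h2, h3⟩ := runPattern_meets_gadget (b := b) (c := c) (j := j) hℓ (by omega) hk2 hk
    (fun i m hi hm him => by
      rw [← h' i (by omega), ← h m (by omega)]
      congr 1
      have : (i : ZMod n) + k = m + j := by exact_mod_cast congrArg (Nat.cast (R := ZMod n)) him
      linear_combination e + this)
  refine ⟨h1, h2, ?_⟩
  rw [h3] at e
  unfold gadgetRun
  cases b
  · simp at e ⊢; exact e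
  · simp at e ⊢; linear_combination e

/-- Neither before nor after the flip does such a run, with its delimiters, meet the flipped block.
Length 1 has to be excluded, because the flip trades an isolated zero for an isolated one. -/
lemma runSites_flipAt_of_ne {b c : Bool} {ℓ L : ℕ} (hL : L + 3 ≤ n) (hℓ : 2 ≤ ℓ) (hne : ℓ ≠ L)
    {x : ZMod n → Bool} {s : ZMod n} (h : Matches (gadget b L) (L + 3) x s) :
    runSites c ℓ (flipAt L s x) = runSites c ℓ x := by
  ext t
  rw [mem_runSites, mem_runSites]
  constructor
  · intro h'
    rw [← flipAt_flipAt L s x, matches_flipAt_iff]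
    · exact h'
    · intro j hj k hk2 hk e
      exact hne (run_meets_gadget hℓ (matches_flipAt_self hL h) h' hj hk2 hk e).1
  · intro h'
    rw [matches_flipAt_iff]
    · exact h'
    · intro j hj k hk2 hk e
      exact hne (run_meets_gadget hℓ h h' hj hk2 hk e).1

lemma gadgetRun_mem_runSites {b : Bool} {L : ℕ} (hL2 : 2 ≤ L)
    {x : ZMod n → Bool} {s : ZMod n} (h : Matches (gadget b L) (L + 3) x s) :
    gadgetRun b s ∈ runSites b L x := by
  rw [mem_runSites]
  intro j hj
  unfold gadgetRun
  cases b
  · have := h j (by omega)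
    simp only [Bool.false_eq_true, if_false, add_zero]
    rw [this]
    unfold gadget runPattern
    split_ifs <;> first | omega | simp_all
  · have := h (j + 1) (by omega)
    have e : s + (if true = true then 1 else 0) + (j : ZMod n) = s + ((j + 1 : ℕ) : ZMod n) := by
      simp; ring
    rw [e, this]
    unfold gadget runPattern
    split_ifs <;> first | omega | (simp_all <;> omega)

lemma runSites_flipAt_self {b : Bool} {L : ℕ} (hL2 : 2 ≤ L) (hL : L + 3 ≤ n)
    {x : ZMod n → Bool} {s : ZMod n} (h : Matches (gadget b L) (L + 3) x s) :
    runSites b L (flipAt L s x) = (runSites b L x).erase (gadgetRun b s) := by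
  have hf := matches_flipAt_self hL h
  ext t
  rw [mem_erase, mem_runSites, mem_runSites]
  constructor
  · intro h'
    constructor
    · rintro rfl
      have h1 := h' 1 (by omega)
      have h2 := h' 2 (by omega)
      have e1 := hf 2 (by omega)
      have e2 : gadget (!b) L 2 = !b := by simp [gadget, hL2]
      rw [e2] at e1
      have r1 : runPattern b L 1 = b := by unfold runPattern; rw [if_neg (by omega)]
      have r2 : runPattern b L 2 = b := by unfold runPattern; rw [if_neg (by omega)]
      rw [r1] at h1
      rw [r2] at h2
      cases b
      · rw [gadgetRun] at h2
        simp at h2 e1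
        rw [h2] at e1; simp at e1
      · rw [gadgetRun] at h1
        have : s + (if true = true then 1 else 0) + ((1 : ℕ) : ZMod n) = s + ((2 : ℕ) : ZMod n) := by
          push_cast; simp; ring
        rw [this, e1] at h1; simp at h1
    · rw [← flipAt_flipAt L s x, matches_flipAt_iff]
      · exact h'
      · intro j hj k hk2 hk e
        have := (run_meets_gadget hL2 hf h' hj hk2 hk e).2.1
        simp at this
  · rintro ⟨hne, h'⟩
    rw [matches_flipAt_iff]
    · exact h'
    · intro j hj k hk2 hk e
      exact hne (run_meets_gadget hL2 h h' hj hk2 hk e).2.2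

lemma card_runSites_flipAt {b : Bool} {L : ℕ} (hL2 : 2 ≤ L) (hL : L + 3 ≤ n)
    {x : ZMod n → Bool} {s : ZMod n} (h : Matches (gadget b L) (L + 3) x s) :
    (runSites b L (flipAt L s x)).card + 1 = (runSites b L x).card := by
  rw [runSites_flipAt_self hL2 hL h, card_erase_add_one (gadgetRun_mem_runSites hL2 h)]

lemma card_runSites_not_flipAt {b : Bool} {L : ℕ} (hL2 : 2 ≤ L) (hL : L + 3 ≤ n)
    {x : ZMod n → Bool} {s : ZMod n} (h : Matches (gadget b L) (L + 3) x s) :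
    (runSites (!b) L (flipAt L s x)).card = (runSites (!b) L x).card + 1 := by
  rw [← card_runSites_flipAt hL2 hL (matches_flipAt_self hL h), flipAt_flipAt]

lemma gadgetSites_flipAt_of_ne {b b' : Bool} {L L' : ℕ} (hL : L + 3 ≤ n) (hL' : 1 ≤ L')
    (hne : L ≠ L') {x : ZMod n → Bool} {s : ZMod n} (h : Matches (gadget b L) (L + 3) x s) :
    gadgetSites b' L' (flipAt L s x) = gadgetSites b' L' x := by
  ext t
  rw [mem_gadgetSites, mem_gadgetSites]
  constructor
  · intro h'
    rw [← flipAt_flipAt L s x, matches_flipAt_iff]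
    · exact h'
    · intro j hj k hk2 hk e
      exact hne (gadgets_meet (matches_flipAt_self hL h) h' (by omega) hk2 hk hL' e).2.1
  · intro h'
    rw [matches_flipAt_iff]
    · exact h'
    · intro j hj k hk2 hk e
      exact hne (gadgets_meet h h' (by omega) hk2 hk hL' e).2.1

lemma not_mem_gadgetSites_not {b : Bool} {L : ℕ} (hL2 : 2 ≤ L) {x : ZMod n → Bool} {s : ZMod n}
    (h : s ∈ gadgetSites b L x) : s ∉ gadgetSites (!b) L x := by
  rw [mem_gadgetSites] at h ⊢
  intro h'
  have e1 := h 2 (by omega)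
  have e2 := h' 2 (by omega)
  rw [e1] at e2
  simp [gadget, hL2] at e2

lemma gadgetSites_flipAt_self {b : Bool} {L : ℕ} (hL2 : 2 ≤ L) (hL : L + 3 ≤ n)
    {x : ZMod n → Bool} {s : ZMod n} (h : Matches (gadget b L) (L + 3) x s) :
    gadgetSites b L (flipAt L s x) = (gadgetSites b L x).erase s := by
  have hf := matches_flipAt_self hL h
  ext t
  rw [mem_erase]
  by_cases hts : t = s
  · subst hts
    have := not_mem_gadgetSites_not hL2 (mem_gadgetSites.2 hf)
    rw [Bool.not_not] at this
    simp [this]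
  · rw [mem_gadgetSites, mem_gadgetSites]
    constructor
    · intro h'
      refine ⟨hts, ?_⟩
      rw [← flipAt_flipAt L s x, matches_flipAt_iff]
      · exact h'
      · intro j hj k hk2 hk e
        exact hts (gadgets_meet hf h' (by omega) hk2 hk (by omega) e).1.symm
    · rintro ⟨-, h'⟩
      rw [matches_flipAt_iff]
      · exact h'
      · intro j hj k hk2 hk e
        exact hts (gadgets_meet h h' (by omega) hk2 hk (by omega) e).1.symm

lemma card_gadgetSites_flipAt {b : Bool} {L : ℕ} (hL2 : 2 ≤ L) (hL : L + 3 ≤ n)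
    {x : ZMod n → Bool} {s : ZMod n} (h : Matches (gadget b L) (L + 3) x s) :
    (gadgetSites b L (flipAt L s x)).card + 1 = (gadgetSites b L x).card := by
  rw [gadgetSites_flipAt_self hL2 hL h, card_erase_add_one (mem_gadgetSites.2 h)]

lemma card_gadgetSites_not_flipAt {b : Bool} {L : ℕ} (hL2 : 2 ≤ L) (hL : L + 3 ≤ n)
    {x : ZMod n → Bool} {s : ZMod n} (h : Matches (gadget b L) (L + 3) x s) :
    (gadgetSites (!b) L (flipAt L s x)).card = (gadgetSites (!b) L x).card + 1 := by
  rw [← card_gadgetSites_flipAt hL2 hL (matches_flipAt_self hL h), flipAt_flipAt]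

lemma card_sites {L : ℕ} (hL2 : 2 ≤ L) (x : ZMod n → Bool) :
    (sites L x).card = (gadgetSites true L x).card + (gadgetSites false L x).card := by
  rw [sites, card_union_of_disjoint]
  rw [disjoint_left]
  intro s hs
  exact not_mem_gadgetSites_not hL2 hs

end Flip

/-! ### Central binomial probabilities -/

/-- The largest probability of a value of a binomial variable with `k` fair trials. -/
noncomputable def centralProb (k : ℕ) : ℝ := (k.choose (k / 2) : ℝ) / 2 ^ k

lemma centralProb_nonneg (k : ℕ) : 0 ≤ centralProb k := by unfold centralProb; positivity

/-- The factor 2m + 1 makes the induction close, by (2m + 1)(2m + 3) ≤ (2m + 2)². -/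
lemma centralBinom_sq_le (m : ℕ) : (2 * m + 1) * m.centralBinom ^ 2 ≤ 16 ^ m := by
  induction m with
  | zero => simp
  | succ m ih =>
    have h := Nat.succ_mul_centralBinom_succ m
    have h2 : (m + 1) ^ 2 * ((2 * (m + 1) + 1) * (m + 1).centralBinom ^ 2)
        ≤ (m + 1) ^ 2 * 16 ^ (m + 1) := by
      calc (m + 1) ^ 2 * ((2 * (m + 1) + 1) * (m + 1).centralBinom ^ 2)
          = (2 * m + 3) * ((m + 1) * (m + 1).centralBinom) ^ 2 := by ring
        _ = (2 * m + 3) * (2 * (2 * m + 1) * m.centralBinom) ^ 2 := by rw [h]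
        _ = (4 * (2 * m + 3) * (2 * m + 1)) * ((2 * m + 1) * m.centralBinom ^ 2) := by ring
        _ ≤ (16 * (m + 1) ^ 2) * 16 ^ m := by
            apply Nat.mul_le_mul _ ih
            nlinarith
        _ = (m + 1) ^ 2 * 16 ^ (m + 1) := by ring
    exact Nat.le_of_mul_le_mul_left h2 (by positivity)

lemma centralProb_sq_le (k : ℕ) : centralProb k ^ 2 ≤ 1 / (k + 1) := by
  have key : (k + 1) * (k.choose (k / 2)) ^ 2 ≤ 4 ^ k := by
    rcases Nat.even_or_odd' k with ⟨m, rfl | rfl⟩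
    · have := centralBinom_sq_le m
      rw [Nat.centralBinom_eq_two_mul_choose] at this
      rw [show 2 * m / 2 = m by omega, pow_mul]
      exact this
    · have := centralBinom_sq_le (m + 1)
      -- The central coefficient of an odd row is half of that of the next even row.
      have e : (m + 1).centralBinom = 2 * (2 * m + 1).choose m := by
        rw [Nat.centralBinom_eq_two_mul_choose, show 2 * (m + 1) = 2 * m + 1 + 1 by ring,
          Nat.choose_succ_succ, ← Nat.choose_symm_half m]
        ring
      rw [e] at this
      rw [show (2 * m + 1) / 2 = m by omega]
      have e2 : 4 * 4 ^ (2 * m + 1) = 16 ^ (m + 1) := by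
        rw [show (16 : ℕ) = 4 ^ 2 by norm_num, ← pow_mul, ← pow_succ']
        congr 1
      nlinarith
  unfold centralProb
  rw [div_pow, div_le_div_iff₀ (by positivity) (by positivity), one_mul]
  have : ((2 : ℝ) ^ k) ^ 2 = 4 ^ k := by rw [← pow_mul, mul_comm, pow_mul]; norm_num
  rw [this, mul_comm]
  exact_mod_cast key

/-- A sequence with the recursion of the binomial coefficients of `k` has no entry that exceeds
the central fraction of its sum. -/
lemma le_centralProb_mul_sum {k : ℕ} {f : ℕ → ℝ} (h0 : ∀ m, 0 ≤ f m)
    (h : ∀ m < k, ((k : ℝ) - m) * f m = (m + 1) * f (m + 1)) {m : ℕ} (hm : m ≤ k) :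
    f m ≤ centralProb k * ∑ i ∈ range (k + 1), f i := by
  have hf : ∀ m ≤ k, f m = k.choose m * f 0 := by
    intro m
    induction m with
    | zero => simp
    | succ m ih =>
      intro hm
      have h1 := h m (by omega)
      rw [ih (by omega)] at h1
      have h2 := Nat.choose_succ_right_eq k m
      have h3 : (k.choose (m + 1) : ℝ) * (m + 1) = k.choose m * (k - m) := by
        rw [← Nat.cast_sub (by omega)]; exact_mod_cast h2
      have : ((m : ℝ) + 1) * f (m + 1) = (m + 1) * (k.choose (m + 1) * f 0) := by
        rw [← h1]; linear_combination -f 0 * h3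
      exact mul_left_cancel₀ (by positivity) this
  have hs : ∑ i ∈ range (k + 1), f i = 2 ^ k * f 0 := by
    rw [sum_congr rfl (fun i hi => hf i (by simp at hi; omega)), ← sum_mul]
    congr 1
    exact_mod_cast Nat.sum_range_choose k
  rw [hs, hf m hm, centralProb]
  have : (k.choose m : ℝ) ≤ k.choose (k / 2) := by exact_mod_cast Nat.choose_le_middle m k
  have h2 : (k.choose (k / 2) : ℝ) / 2 ^ k * (2 ^ k * f 0) = k.choose (k / 2) * f 0 := by
    field_simp
  rw [h2]
  exact mul_le_mul_of_nonneg_right this (h0 0)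

/-! ### Littlewood–Offord argument for one level -/

section Tie

variable {n : ℕ} [NeZero n]

/-- `x` has equally many runs of ones and of zeros of length `ℓ`. -/
def Tied (ℓ : ℕ) (x : ZMod n → Bool) : Prop :=
  (runSites true ℓ x).card = (runSites false ℓ x).card

/-- `W` takes the same value on two words that differ by flipping a gadget of level `L`. -/
def FlipInvariant {β : Type*} (L : ℕ) (W : (ZMod n → Bool) → β) : Prop :=
  ∀ (b : Bool) (s : ZMod n) (x : ZMod n → Bool), Matches (gadget b L) (L + 3) x s →
    W (flipAt L s x) = W x

/-- Flipping is a bijection between words with a marked gadget of middle letter 0 and words with a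
marked gadget of middle letter 1. -/
lemma sum_flip {L : ℕ} (hL : L + 3 ≤ n) (F : (ZMod n → Bool) → ℝ) :
    ∑ x, (gadgetSites false L x).card * F x =
      ∑ x, ∑ s ∈ gadgetSites true L x, F (flipAt L s x) := by
  have : ∀ x, ((gadgetSites false L x).card : ℝ) * F x
      = ∑ s ∈ gadgetSites false L x, F x := by intro x; simp
  simp only [this]
  rw [sum_sigma', sum_sigma']
  refine sum_bij' (fun p _ => ⟨flipAt L p.2 p.1, p.2⟩) (fun p _ => ⟨flipAt L p.2 p.1, p.2⟩)
    ?_ ?_ ?_ ?_ ?_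
  · rintro ⟨x, s⟩ h
    simp only [mem_sigma, mem_univ, true_and, mem_gadgetSites] at h ⊢
    exact matches_flipAt_self hL h
  · rintro ⟨x, s⟩ h
    simp only [mem_sigma, mem_univ, true_and, mem_gadgetSites] at h ⊢
    exact matches_flipAt_self hL h
  · rintro ⟨x, s⟩ h; simp [flipAt_flipAt]
  · rintro ⟨x, s⟩ h; simp [flipAt_flipAt]
  · rintro ⟨x, s⟩ h; simp [flipAt_flipAt]

open Classical in
-- Double counting of flips shows that the weight of the words with m gadgets of middle letter 1
-- satisfies (k - m) f(m) = (m + 1) f(m + 1). It is therefore proportional to the binomial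
-- coefficients of k.
lemma sum_gadgetSites_eq_le {L k : ℕ} (hL2 : 2 ≤ L) (hL : L + 3 ≤ n)
    {W : (ZMod n → Bool) → ℝ} (hW0 : ∀ x, 0 ≤ W x) (hW : FlipInvariant L W)
    (hk : ∀ x, W x ≠ 0 → (sites L x).card = k) (m : ℕ) :
    ∑ x, (if (gadgetSites true L x).card = m then W x else 0) ≤ centralProb k * ∑ x, W x := by
  set f : ℕ → ℝ := fun m => ∑ x, if (gadgetSites true L x).card = m then W x else 0 with hf
  have hf0 : ∀ m, 0 ≤ f m := fun m => sum_nonneg fun x _ => by split_ifs <;> simp [hW0]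
  have hrec : ∀ m < k, ((k : ℝ) - m) * f m = (m + 1) * f (m + 1) := by
    intro m _
    have h1 := sum_flip hL (fun x => if (gadgetSites true L x).card = m then W x else 0)
    have h2 : ∀ x, ((gadgetSites false L x).card : ℝ) *
        (if (gadgetSites true L x).card = m then W x else 0)
        = ((k : ℝ) - m) * (if (gadgetSites true L x).card = m then W x else 0) := by
      intro x
      split_ifs with h
      · by_cases hx : W x = 0
        · simp [hx]
        · have := hk x hx
          rw [card_sites hL2, h] at this
          rw [← this]; push_cast; ring
      · simp
    have h3 : ∀ x, ∑ s ∈ gadgetSites true L x,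
        (if (gadgetSites true L (flipAt L s x)).card = m then W (flipAt L s x) else 0)
        = ((m : ℝ) + 1) * (if (gadgetSites true L x).card = m + 1 then W x else 0) := by
      intro x
      have : ∀ s ∈ gadgetSites true L x,
          (if (gadgetSites true L (flipAt L s x)).card = m then W (flipAt L s x) else 0)
          = if (gadgetSites true L x).card = m + 1 then W x else 0 := by
        intro s hs
        rw [mem_gadgetSites] at hs
        rw [hW true s x hs, ← card_gadgetSites_flipAt hL2 hL hs]
        simp
      rw [sum_congr rfl this, sum_const, nsmul_eq_mul]
      split_ifs with h
      · rw [h]; push_cast; ring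
      · simp
    simp only [h2, h3, ← mul_sum] at h1
    exact h1
  have htot : ∑ i ∈ range (k + 1), f i = ∑ x, W x := by
    rw [hf, sum_comm]
    refine sum_congr rfl fun x _ => ?_
    by_cases hx : W x = 0
    · simp [hx]
    · have := hk x hx
      rw [card_sites hL2] at this
      rw [sum_ite_eq, if_pos]
      simp; omega
  rcases le_or_gt m k with hm | hm
  · rw [← htot]; exact le_centralProb_mul_sum hf0 hrec hm
  · have : f m = 0 := by
      refine sum_eq_zero fun x _ => ?_
      split_ifs with h
      · by_contra hx
        have := hk x hx
        rw [card_sites hL2] at this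
        omega
      · rfl
    change f m ≤ _
    rw [this]
    exact mul_nonneg (centralProb_nonneg k) (sum_nonneg fun x _ => hW0 x)

/-- Littlewood–Offord bound for the event that level `L` is tied. -/
lemma sum_tied_le {L : ℕ} (hL2 : 2 ≤ L) (hL : L + 3 ≤ n) {W : (ZMod n → Bool) → ℝ}
    (hW0 : ∀ x, 0 ≤ W x) (hW : FlipInvariant L W) {P : (ZMod n → Bool) → Prop} [DecidablePred P]
    (hP : ∀ x, P x → Tied L x) :
    ∑ x, (if P x then W x else 0) ≤ ∑ x, W x * centralProb (sites L x).card := by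
  classical
  -- A flip changes the difference of the run counts by ±2 and the number of gadgets with letter 1
  -- by ±1, so both components are invariant. On a class of `I`, a tie forces that number to be
  -- minus half of the second component.
  let I : (ZMod n → Bool) → ℕ × ℤ := fun x => ((sites L x).card,
    ((runSites true L x).card : ℤ) - (runSites false L x).card
      - 2 * (gadgetSites true L x).card)
  have hI : FlipInvariant L I := by
    intro b s x h
    have a1 := card_runSites_flipAt hL2 hL h
    have a2 := card_runSites_not_flipAt hL2 hL h
    have a3 := card_gadgetSites_flipAt hL2 hL h
    have a4 := card_gadgetSites_not_flipAt hL2 hL h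
    simp only [I, card_sites hL2]
    cases b <;> simp only [Bool.not_true, Bool.not_false] at a2 a4 <;>
      · refine Prod.ext ?_ ?_ <;> dsimp only <;> omega
  rw [← sum_fiberwise_of_maps_to (t := univ.image I) (g := I) (by simp),
    ← sum_fiberwise_of_maps_to (t := univ.image I) (g := I) (f := fun x => W x * _) (by simp)]
  refine sum_le_sum fun c _ => ?_
  let V : (ZMod n → Bool) → ℝ := fun x => if I x = c then W x else 0
  have hV0 : ∀ x, 0 ≤ V x := fun x => by simp only [V]; split_ifs <;> simp [hW0]
  have hV : FlipInvariant L V := by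
    intro b s x h
    simp only [V, hI b s x h, hW b s x h]
  have hVk : ∀ x, V x ≠ 0 → (sites L x).card = c.1 := by
    intro x hx
    have : I x = c := by by_contra h; simp [V, h] at hx
    rw [← this]
  have hr : ∑ x with I x = c, W x * centralProb (sites L x).card
      = centralProb c.1 * ∑ x, V x := by
    rw [sum_filter, mul_sum]
    refine sum_congr rfl fun x _ => ?_
    simp only [V]
    split_ifs with h
    · rw [← h]; ring
    · simp
  rw [hr]
  refine le_trans ?_ (sum_gadgetSites_eq_le hL2 hL hV0 hV hVk (-c.2 / 2).toNat)
  rw [sum_filter]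
  refine sum_le_sum fun x _ => ?_
  by_cases h : I x = c
  · by_cases hx : P x
    · have ht := hP x hx
      have : (gadgetSites true L x).card = (-c.2 / 2).toNat := by
        rw [← h]
        simp only [I]
        unfold Tied at ht
        omega
      simp [h, hx, V, this]
    · simp only [h, hx, if_true, if_false]
      split_ifs <;> simp [hV0]
  · simp only [h, if_false]
    split_ifs <;> simp [hV0]

end Tie

/-! ### Inverse moments of the numbers of gadgets -/

section InverseMoment

variable {n : ℕ} [NeZero n]

lemma overwrite_apply_ne {p : ℕ → Bool} {w : ℕ} {s t : ZMod n} {x : ZMod n → Bool}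
    (h : overwrite p w s x t ≠ x t) : ∃ k < w, t = s + (k : ZMod n) := by
  refine ⟨(t - s).val, ?_, eq_add_val s t⟩
  by_contra hlt
  exact h (by simp [overwrite, hlt])

lemma card_sites_overwrite_le {p : ℕ → Bool} {L w : ℕ} (hL : 1 ≤ L) (hw : w ≤ L + 5)
    (s : ZMod n) (x : ZMod n → Bool) :
    (sites L (overwrite p w s x)).card ≤ (sites L x).card + 5 := by
  classical
  set y := overwrite p w s x with hy
  -- A new gadget meets the window. Its last letter is located relative to `s`, so that the offset
  -- `m` is nonnegative.
  have hnew : ∀ t ∈ sites L y \ sites L x,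
      ∃ m, m ≤ w + L + 1 ∧ t + ((L + 2 : ℕ) : ZMod n) = s + (m : ZMod n) := by
    intro t ht
    rw [mem_sdiff, mem_sites, mem_sites] at ht
    obtain ⟨⟨b, hb⟩, hnot⟩ := ht
    have : ∃ j < L + 3, y (t + j) ≠ x (t + j) := by
      by_contra hcon
      push Not at hcon
      exact hnot ⟨b, fun j hj => by rw [← hcon j hj, hb j hj]⟩
    obtain ⟨j, hj, hne⟩ := this
    obtain ⟨k, hk, e⟩ := overwrite_apply_ne hne
    refine ⟨k + (L + 2 - j), by omega, ?_⟩
    rw [Nat.cast_add k, Nat.cast_sub (by omega)]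
    linear_combination e
  choose! m hm using hnew
  have hcard : (sites L y \ sites L x).card ≤ (range 5).card := by
    -- Offsets are at most 2L + 6 < 5(L + 1), and each block of L + 1 consecutive offsets holds at
    -- most one gadget.
    refine card_le_card_of_injOn (fun t => m t / (L + 1)) ?_ ?_
    · intro t ht
      have := (hm t ht).1
      simp only [coe_range, Set.mem_Iio]
      rw [Nat.div_lt_iff_lt_mul (by omega)]
      omega
    · have sep : ∀ t ∈ sites L y \ sites L x, ∀ t' ∈ sites L y \ sites L x,
          m t / (L + 1) = m t' / (L + 1) → ¬ m t < m t' := by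
        intro t ht t' ht' e hlt
        have h1 := (hm t ht).2
        have h2 := (hm t' ht').2
        obtain ⟨b, hb⟩ := mem_sites.1 (mem_sdiff.1 ht).1
        obtain ⟨b', hb'⟩ := mem_sites.1 (mem_sdiff.1 ht').1
        have hd : t' = t + ((m t' - m t : ℕ) : ZMod n) := by
          rw [Nat.cast_sub hlt.le]; linear_combination h2 - h1
        rw [hd] at hb'
        refine gadget_sep hb (by omega) ?_ hb'
        have a1 := Nat.div_add_mod (m t) (L + 1)
        have a2 := Nat.div_add_mod (m t') (L + 1)
        have a3 := Nat.mod_lt (m t') (show L + 1 > 0 by omega)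
        rw [e] at a1
        omega
      intro t ht t' ht' e
      have hmm : m t = m t' :=
        le_antisymm (not_lt.1 (sep t' ht' t ht e.symm)) (not_lt.1 (sep t ht t' ht' e))
      have h1 := (hm t ht).2
      have h2 := (hm t' ht').2
      rw [hmm] at h1
      linear_combination h1 - h2
  have hsub : sites L y ⊆ sites L x ∪ (sites L y \ sites L x) := by
    intro t ht
    by_cases h : t ∈ sites L x <;> simp [h, ht]
  calc (sites L y).card ≤ _ := card_le_card hsub
    _ ≤ _ := card_union_le _ _
    _ ≤ _ := by simpa using hcard

/-- Planting a gadget at each position of `U` bounds the inverse moment of the number of gadgets. -/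
lemma card_mul_sum_div_sites_le {L : ℕ} (hL : 1 ≤ L) (hLn : L + 3 ≤ n) (U : Finset (ZMod n))
    {W V : (ZMod n → Bool) → ℝ} (hV : ∀ x, 0 ≤ V x)
    (hWV : ∀ s ∈ U, ∀ x, W x ≤ V (overwrite (gadget true L) (L + 3) s x)) :
    U.card * ∑ x, W x / ((sites L x).card + 6) ≤ 2 ^ (L + 3) * ∑ x, V x := by
  classical
  calc (U.card : ℝ) * ∑ x, W x / ((sites L x).card + 6)
      = ∑ s ∈ U, ∑ x, W x / ((sites L x).card + 6) := by rw [sum_const, nsmul_eq_mul]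
    _ ≤ ∑ s ∈ U, ∑ x, (fun y => V y / ((sites L y).card + 1))
          (overwrite (gadget true L) (L + 3) s x) := by
        refine sum_le_sum fun s hs => sum_le_sum fun x _ => ?_
        have h1 := card_sites_overwrite_le (p := gadget true L) (w := L + 3) hL (by omega) s x
        have h2 : ((sites L (overwrite (gadget true L) (L + 3) s x)).card : ℝ) + 1
            ≤ (sites L x).card + 6 := by
          have : ((sites L (overwrite (gadget true L) (L + 3) s x)).card : ℝ)
            ≤ (sites L x).card + 5 := by exact_mod_cast h1
          linarith
        exact div_le_div₀ (hV _) (hWV s hs x) (by positivity) h2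
    _ = 2 ^ (L + 3) * ∑ s ∈ U, ∑ x, if Matches (gadget true L) (L + 3) x s
          then V x / ((sites L x).card + 1) else 0 := by
        rw [mul_sum]
        exact sum_congr rfl fun s _ => sum_overwrite hLn s fun y => V y / ((sites L y).card + 1)
    _ ≤ 2 ^ (L + 3) * ∑ x, V x := by
        refine mul_le_mul_of_nonneg_left ?_ (by positivity)
        -- For a fixed word, the positions of `U` that match number at most the gadgets, which
        -- cancels the denominator.
        rw [sum_comm]
        refine sum_le_sum fun x _ => ?_
        rw [← sum_filter, sum_const, nsmul_eq_mul]
        have hle : ((U.filter fun s => Matches (gadget true L) (L + 3) x s).card : ℝ)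
            ≤ (sites L x).card + 1 := by
          have : (U.filter fun s => Matches (gadget true L) (L + 3) x s) ⊆ sites L x := by
            intro s hs
            exact mem_sites.2 ⟨true, (mem_filter.1 hs).2⟩
          have : ((U.filter fun s => Matches (gadget true L) (L + 3) x s).card : ℝ)
            ≤ (sites L x).card := by exact_mod_cast card_le_card this
          linarith
        rw [← mul_div_assoc, div_le_iff₀ (by positivity), mul_comm]
        exact mul_le_mul_of_nonneg_left hle (hV x)

lemma inv_sites_le_overwrite {p : ℕ → Bool} {L w : ℕ} (hL : 1 ≤ L) (hw : w ≤ L + 5)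
    (s : ZMod n) (x : ZMod n → Bool) {c d : ℝ} (hc : 0 < c) (hd : d = c + 5) :
    1 / ((sites L x).card + d) ≤ 1 / ((sites L (overwrite p w s x)).card + c) := by
  have h : ((sites L (overwrite p w s x)).card : ℝ) ≤ (sites L x).card + 5 := by
    exact_mod_cast card_sites_overwrite_le hL hw s x
  exact one_div_le_one_div_of_le (by positivity) (by linarith)

/-- The three levels are planted in turn. Each planting adds at most 5 gadgets to any of the levels,
so the shifts 6, 11, 16 leave room for those still to come. The widest window, a + 6, is (a + 1) + 5
for the lowest level. -/
lemma card_pow_mul_sum_div_sites_le {a : ℕ} (han : a + 6 ≤ n) (U : Finset (ZMod n))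
    {W : (ZMod n → Bool) → ℝ} (hW0 : ∀ x, 0 ≤ W x)
    (hW : ∀ (p : ℕ → Bool), ∀ w ≤ a + 6, ∀ s ∈ U, ∀ x, W (overwrite p w s x) = W x) :
    (U.card : ℝ) ^ 3 * ∑ x, W x * (1 / ((sites (a + 1) x).card + 6)) *
        (1 / ((sites (a + 2) x).card + 11)) * (1 / ((sites (a + 3) x).card + 16))
      ≤ 2 ^ (3 * a + 15) * ∑ x, W x := by
  have h1 := card_mul_sum_div_sites_le (n := n) (L := a + 1) (by omega) (by omega) U
    (W := fun x => W x * (1 / ((sites (a + 2) x).card + 11)) *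
      (1 / ((sites (a + 3) x).card + 16)))
    (V := fun x => W x * (1 / ((sites (a + 2) x).card + 6)) *
      (1 / ((sites (a + 3) x).card + 11)))
    (fun x => by have := hW0 x; positivity)
    (fun s hs x => by
      have := hW0 x
      rw [hW _ _ (by omega) s hs x]
      exact mul_le_mul (mul_le_mul_of_nonneg_left (inv_sites_le_overwrite (by omega) (by omega)
        s x (by norm_num) (by norm_num)) this) (inv_sites_le_overwrite (by omega) (by omega)
        s x (by norm_num) (by norm_num)) (by positivity) (by positivity))
  have h2 := card_mul_sum_div_sites_le (n := n) (L := a + 2) (by omega) (by omega) U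
    (W := fun x => W x * (1 / ((sites (a + 3) x).card + 11)))
    (V := fun x => W x * (1 / ((sites (a + 3) x).card + 6)))
    (fun x => by have := hW0 x; positivity)
    (fun s hs x => by
      have := hW0 x
      rw [hW _ _ (by omega) s hs x]
      exact mul_le_mul_of_nonneg_left (inv_sites_le_overwrite (by omega) (by omega)
        s x (by norm_num) (by norm_num)) this)
  have h3 := card_mul_sum_div_sites_le (n := n) (L := a + 3) (by omega) (by omega) U
    (W := W) (V := W) hW0 (fun s hs x => (hW _ _ (by omega) s hs x).ge)
  have e1 : ∑ x, W x * (1 / ((sites (a + 1) x).card + 6 : ℝ)) *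
        (1 / ((sites (a + 2) x).card + 11)) * (1 / ((sites (a + 3) x).card + 16))
      = ∑ x, W x * (1 / ((sites (a + 2) x).card + 11 : ℝ)) *
      (1 / ((sites (a + 3) x).card + 16)) / ((sites (a + 1) x).card + 6) :=
    sum_congr rfl fun x _ => by ring
  have e2 : ∑ x, W x * (1 / ((sites (a + 2) x).card + 6 : ℝ)) *
      (1 / ((sites (a + 3) x).card + 11))
      = ∑ x, W x * (1 / ((sites (a + 3) x).card + 11 : ℝ)) / ((sites (a + 2) x).card + 6) :=
    sum_congr rfl fun x _ => by ring
  have e3 : ∑ x, W x * (1 / ((sites (a + 3) x).card + 6 : ℝ))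
      = ∑ x, W x / ((sites (a + 3) x).card + 6) := sum_congr rfl fun x _ => by ring
  rw [e2] at h1
  rw [e3] at h2
  rw [e1]
  have hu : (0 : ℝ) ≤ U.card := by positivity
  calc (U.card : ℝ) ^ 3 * _ = (U.card : ℝ) ^ 2 * (U.card * ∑ x, W x * (1 / ((sites (a + 2) x).card + 11 : ℝ)) *
      (1 / ((sites (a + 3) x).card + 16)) / ((sites (a + 1) x).card + 6)) := by ring
    _ ≤ (U.card : ℝ) ^ 2 * _ := mul_le_mul_of_nonneg_left h1 (by positivity)
    _ = 2 ^ (a + 1 + 3) * U.card * (U.card *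
        ∑ x, W x * (1 / ((sites (a + 3) x).card + 11 : ℝ)) / ((sites (a + 2) x).card + 6)) := by ring
    _ ≤ 2 ^ (a + 1 + 3) * U.card * _ := mul_le_mul_of_nonneg_left h2 (by positivity)
    _ = 2 ^ (a + 1 + 3) * 2 ^ (a + 2 + 3) * (U.card *
        ∑ x, W x / ((sites (a + 3) x).card + 6)) := by ring
    _ ≤ 2 ^ (a + 1 + 3) * 2 ^ (a + 2 + 3) * _ := mul_le_mul_of_nonneg_left h3 (by positivity)
    _ = 2 ^ (3 * a + 15) * ∑ x, W x := by ring

end InverseMoment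

/-! ### Three tied levels at once -/

section TiedLevels

variable {n : ℕ} [NeZero n]

lemma tied_flipAt {ℓ L : ℕ} (hL : L + 3 ≤ n) (hℓ : 2 ≤ ℓ) (hne : ℓ ≠ L) :
    FlipInvariant (n := n) L (Tied ℓ) := by
  intro b s x h
  simp only [Tied, runSites_flipAt_of_ne hL hℓ hne h]

lemma sites_flipAt {ℓ L : ℕ} (hL : L + 3 ≤ n) (hℓ : 1 ≤ ℓ) (hne : L ≠ ℓ) :
    FlipInvariant (n := n) L (sites ℓ) := by
  intro b s x h
  simp only [sites, gadgetSites_flipAt_of_ne hL hℓ hne h]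

open Classical in
-- Each application of `sum_tied_le` trades the indicator of one tie for a central probability. The
-- remaining weight stays invariant, because flips at one level preserve the ties and the gadgets of
-- the other two.
lemma sum_tied_three_le {a : ℕ} (ha : 1 ≤ a) (han : a + 6 ≤ n) {W : (ZMod n → Bool) → ℝ}
    (hW0 : ∀ x, 0 ≤ W x) (hW : ∀ L, a < L → L + 3 ≤ n → FlipInvariant L W) :
    ∑ x, (if Tied (a + 1) x ∧ Tied (a + 2) x ∧ Tied (a + 3) x then W x else 0) ≤
      ∑ x, W x * centralProb (sites (a + 1) x).card * centralProb (sites (a + 2) x).card *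
        centralProb (sites (a + 3) x).card := by
  have c0 := centralProb_nonneg
  have s1 := sum_tied_le (n := n) (L := a + 1) (by omega) (by omega)
    (W := fun x => if Tied (a + 2) x ∧ Tied (a + 3) x then W x else 0)
    (fun x => by split_ifs <;> simp [hW0])
    (fun b s x h => by
      simp only [tied_flipAt (n := n) (L := a + 1) (ℓ := a + 2) (by omega) (by omega) (by omega) b s x h,
        tied_flipAt (n := n) (L := a + 1) (ℓ := a + 3) (by omega) (by omega) (by omega) b s x h,
        hW (a + 1) (by omega) (by omega) b s x h])
    (P := Tied (a + 1)) (fun x h => h)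
  have s2 := sum_tied_le (n := n) (L := a + 2) (by omega) (by omega)
    (W := fun x => if Tied (a + 3) x then W x * centralProb (sites (a + 1) x).card else 0)
    (fun x => by split_ifs <;> simp [mul_nonneg, hW0, c0])
    (fun b s x h => by
      simp only [sites_flipAt (n := n) (L := a + 2) (ℓ := a + 1) (by omega) (by omega) (by omega) b s x h,
        tied_flipAt (n := n) (L := a + 2) (ℓ := a + 3) (by omega) (by omega) (by omega) b s x h,
        hW (a + 2) (by omega) (by omega) b s x h])
    (P := Tied (a + 2)) (fun x h => h)
  have s3 := sum_tied_le (n := n) (L := a + 3) (by omega) (by omega)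
    (W := fun x => W x * centralProb (sites (a + 1) x).card * centralProb (sites (a + 2) x).card)
    (fun x => by have := hW0 x; have := c0 (sites (a + 1) x).card
                 have := c0 (sites (a + 2) x).card; positivity)
    (fun b s x h => by
      simp only [sites_flipAt (n := n) (L := a + 3) (ℓ := a + 1) (by omega) (by omega) (by omega) b s x h,
        sites_flipAt (n := n) (L := a + 3) (ℓ := a + 2) (by omega) (by omega) (by omega) b s x h,
        hW (a + 3) (by omega) (by omega) b s x h])
    (P := Tied (a + 3)) (fun x h => h)
  refine le_trans (le_of_eq ?_) (s1.trans (le_trans (le_of_eq ?_) (s2.trans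
    (le_trans (le_of_eq ?_) s3))))
  · refine sum_congr rfl fun x _ => ?_
    split_ifs <;> simp_all
  · refine sum_congr rfl fun x _ => ?_
    split_ifs <;> simp_all
  · refine sum_congr rfl fun x _ => ?_
    split_ifs <;> simp_all

lemma centralProb_sq_le_div (k : ℕ) {c : ℝ} (hc : 1 ≤ c) :
    centralProb k ^ 2 ≤ c * (1 / (k + c)) := by
  refine (centralProb_sq_le k).trans ?_
  rw [mul_one_div, div_le_div_iff₀ (by positivity) (by positivity)]
  have : (0 : ℝ) ≤ k := by positivity
  nlinarith

open Classical in
/-- The probability that an event that depends on few letters occurs and three consecutive levels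
are tied. -/
lemma sum_tied_three_sq_le {a : ℕ} (ha : 1 ≤ a) (han : a + 6 ≤ n) (U : Finset (ZMod n))
    {E : (ZMod n → Bool) → Prop}
    (hE : ∀ L, a < L → L + 3 ≤ n → FlipInvariant L E)
    (hU : ∀ (p : ℕ → Bool), ∀ w ≤ a + 6, ∀ s ∈ U, ∀ x, E (overwrite p w s x) = E x) :
    (U.card : ℝ) ^ 3 *
      (∑ x, (if E x ∧ Tied (a + 1) x ∧ Tied (a + 2) x ∧ Tied (a + 3) x then (1 : ℝ) else 0)) ^ 2 ≤
      2 ^ (3 * a + 26) * (∑ x, if E x then (1 : ℝ) else 0) ^ 2 := by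
  set W : (ZMod n → Bool) → ℝ := fun x => if E x then 1 else 0 with hWdef
  have hW0 : ∀ x, 0 ≤ W x := fun x => by simp only [W]; split_ifs <;> simp
  have hWW : ∀ x, W x ^ 2 = W x := fun x => by simp only [W]; split_ifs <;> simp
  have t1 := sum_tied_three_le ha han hW0
    (fun L h1 h2 b s x h => by simp only [W, hE L h1 h2 b s x h])
  have t2 := card_pow_mul_sum_div_sites_le han U hW0
    (fun p w h1 s hs x => by simp only [W, hU p w h1 s hs x])
  have e1 : ∑ x, (if E x ∧ Tied (a + 1) x ∧ Tied (a + 2) x ∧ Tied (a + 3) x then (1 : ℝ) else 0)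
      = ∑ x, (if Tied (a + 1) x ∧ Tied (a + 2) x ∧ Tied (a + 3) x then W x else 0) := by
    refine sum_congr rfl fun x _ => ?_
    simp only [W]
    split_ifs <;> simp_all
  rw [e1]
  set T := ∑ x, (if Tied (a + 1) x ∧ Tied (a + 2) x ∧ Tied (a + 3) x then W x else 0) with hT
  have hT0 : 0 ≤ T := sum_nonneg fun x _ => by split_ifs <;> simp [hW0]
  -- Only the squares of the central probabilities are of the order of inverse gadget counts. One
  -- factor `W` is kept on each side, since `W` is an indicator.
  have cs := sum_mul_sq_le_sq_mul_sq univ W (fun x => W x * (centralProb (sites (a + 1) x).card *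
    centralProb (sites (a + 2) x).card * centralProb (sites (a + 3) x).card))
  have e2 : ∑ x, W x * centralProb (sites (a + 1) x).card * centralProb (sites (a + 2) x).card *
        centralProb (sites (a + 3) x).card = ∑ x, W x * (W x * (centralProb (sites (a + 1) x).card *
    centralProb (sites (a + 2) x).card * centralProb (sites (a + 3) x).card)) := by
    refine sum_congr rfl fun x _ => ?_
    rw [← mul_assoc (W x) (W x), ← sq, hWW]; ring
  rw [e2] at t1
  simp only [hWW] at cs
  have e3 : ∑ x, (W x * (centralProb (sites (a + 1) x).card *
      centralProb (sites (a + 2) x).card * centralProb (sites (a + 3) x).card)) ^ 2 ≤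
      -- 1056 = 6 · 11 · 16, and it is at most 2^11 below.
      1056 * ∑ x, W x * (1 / ((sites (a + 1) x).card + 6)) *
        (1 / ((sites (a + 2) x).card + 11)) * (1 / ((sites (a + 3) x).card + 16)) := by
    rw [mul_sum]
    refine sum_le_sum fun x _ => ?_
    rw [mul_pow, mul_pow, mul_pow, hWW]
    have p1 := centralProb_sq_le_div (sites (a + 1) x).card (c := 6) (by norm_num)
    have p2 := centralProb_sq_le_div (sites (a + 2) x).card (c := 11) (by norm_num)
    have p3 := centralProb_sq_le_div (sites (a + 3) x).card (c := 16) (by norm_num)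
    calc _ ≤ W x * (6 * (1 / ((sites (a + 1) x).card + 6)) *
        (11 * (1 / ((sites (a + 2) x).card + 11))) * (16 * (1 / ((sites (a + 3) x).card + 16)))) := by
          have := hW0 x
          gcongr
      _ = _ := by ring
  set S := ∑ x, W x * (1 / ((sites (a + 1) x).card + 6 : ℝ)) *
        (1 / ((sites (a + 2) x).card + 11)) * (1 / ((sites (a + 3) x).card + 16)) with hS
  have hWs : 0 ≤ ∑ x, W x := sum_nonneg fun x _ => hW0 x
  calc (U.card : ℝ) ^ 3 * T ^ 2 ≤ U.card ^ 3 * ((∑ x, W x) * (1056 * S)) := by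
        refine mul_le_mul_of_nonneg_left ?_ (by positivity)
        refine (pow_le_pow_left₀ hT0 t1 2).trans (cs.trans ?_)
        exact mul_le_mul_of_nonneg_left e3 hWs
    _ = 1056 * (∑ x, W x) * (U.card ^ 3 * S) := by ring
    _ ≤ 1056 * (∑ x, W x) * (2 ^ (3 * a + 15) * ∑ x, W x) :=
        mul_le_mul_of_nonneg_left t2 (by positivity)
    _ = 1056 * 2 ^ (3 * a + 15) * (∑ x, W x) ^ 2 := by ring
    _ ≤ 2 ^ (3 * a + 26) * (∑ x, W x) ^ 2 := by
        refine mul_le_mul_of_nonneg_right ?_ (by positivity)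
        rw [show 3 * a + 26 = (3 * a + 15) + 11 by ring, pow_add 2 (3 * a + 15) 11]
        have : (0 : ℝ) ≤ 2 ^ (3 * a + 15) := by positivity
        nlinarith

end TiedLevels

/-! ### Probability that a coordinate is critical -/

section Probability

variable {n : ℕ} [NeZero n]

/-- A run of length `a` starts right after the position `s`; no condition if `a ≤ 1`. -/
def RunAfter (a : ℕ) (s : ZMod n) (x : ZMod n → Bool) : Prop :=
  a ≤ 1 ∨ ∃ c, Matches (runPattern c a) (a + 2) x s

/-- Runs of length 1 are not preserved by flips; dropping the condition for a ≤ 1 restores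
invariance at the cost of a constant factor. -/
lemma runAfter_flipAt {a L : ℕ} (haL : a < L) (hL : L + 3 ≤ n) (s : ZMod n) :
    FlipInvariant L (RunAfter a s) := by
  intro b t x h
  rcases le_or_gt a 1 with ha | ha
  · simp [RunAfter, ha]
  · have : ∀ c, Matches (runPattern c a) (a + 2) (flipAt L t x) s ↔
        Matches (runPattern c a) (a + 2) x s := by
      intro c
      rw [← mem_runSites, ← mem_runSites, runSites_flipAt_of_ne hL ha haL.ne h]
    simp [RunAfter, this]

/-- The excluded number is 2a + 8 = (a + 2) + (a + 6): the window starts after the run and its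
delimiters and ends before coming round the circle to them. -/
lemma runAfter_overwrite {a : ℕ} (s : ZMod n) (p : ℕ → Bool) {w i : ℕ} (hw : w ≤ a + 6)
    (hi : i < n - (2 * a + 8)) (x : ZMod n → Bool) :
    RunAfter a s (overwrite p w (s + ((a + 2 + i : ℕ) : ZMod n)) x) = RunAfter a s x := by
  have key : ∀ j < a + 2, overwrite p w (s + ((a + 2 + i : ℕ) : ZMod n)) x (s + j) = x (s + j) := by
    intro j hj
    by_contra hne
    obtain ⟨k, hk, e⟩ := overwrite_apply_ne hne
    have h1 : s + (j : ZMod n) = s + ((a + 2 + i + k : ℕ) : ZMod n) := by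
      rw [e]; push_cast; ring
    have h2 := congrArg (fun t : ZMod n => (t - s).val) h1
    rw [val_natCast_sub s (by omega), val_natCast_sub s (by omega)] at h2
    omega
  have : ∀ c, Matches (runPattern c a) (a + 2)
      (overwrite p w (s + ((a + 2 + i : ℕ) : ZMod n)) x) s ↔
      Matches (runPattern c a) (a + 2) x s := fun c =>
    forall₂_congr fun j hj => by rw [key j hj]
  simp only [RunAfter, this]

open Classical in
lemma sum_exists_matches_le {p : Bool → ℕ → Bool} {w : ℕ} (hw : w ≤ n) (s : ZMod n) :
    2 ^ w * ∑ x : ZMod n → Bool, (if ∃ c, Matches (p c) w x s then (1 : ℝ) else 0) ≤ 2 * 2 ^ n := by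
  have h : ∑ x : ZMod n → Bool, (if ∃ c, Matches (p c) w x s then (1 : ℝ) else 0) ≤
      (∑ x : ZMod n → Bool, if Matches (p true) w x s then (1 : ℝ) else 0) +
      ∑ x : ZMod n → Bool, if Matches (p false) w x s then (1 : ℝ) else 0 := by
    rw [← sum_add_distrib]
    refine sum_le_sum fun x _ => ?_
    by_cases h1 : Matches (p true) w x s <;> by_cases h2 : Matches (p false) w x s <;>
      simp [h1, h2]
  have h1 := sum_matches (p := p true) hw s
  have h2 := sum_matches (p := p false) hw s
  have h3 : (0 : ℝ) ≤ 2 ^ w := by positivity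
  nlinarith [mul_le_mul_of_nonneg_left h h3]

open Classical in
lemma sum_runAfter_le {a : ℕ} (han : a + 2 ≤ n) (s : ZMod n) :
    2 ^ a * ∑ x : ZMod n → Bool, (if RunAfter a s x then (1 : ℝ) else 0) ≤ 2 * 2 ^ n := by
  rcases le_or_gt a 1 with ha | ha
  · simp only [RunAfter, ha, true_or, if_true]
    have : ∑ x : ZMod n → Bool, (1 : ℝ) = 2 ^ n := by simp [ZMod.card]
    rw [this]
    have : (2 : ℝ) ^ a ≤ 2 := by
      calc (2 : ℝ) ^ a ≤ 2 ^ 1 := pow_le_pow_right₀ (by norm_num) ha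
        _ = 2 := by norm_num
    exact mul_le_mul_of_nonneg_right this (by positivity)
  · have := sum_exists_matches_le (p := fun c => runPattern c a) han s
    simp only [RunAfter, not_le.2 ha, false_or]
    refine le_trans ?_ this
    refine mul_le_mul_of_nonneg_right (pow_le_pow_right₀ (by norm_num) (by omega)) ?_
    exact sum_nonneg fun x _ => by split_ifs <;> simp

open Classical in
-- The bound is 2^{-a} for the run times (2^a/n)^{3/2} for the three ties, up to a constant. The
-- hypothesis on n leaves at least n/2 positions for planting.
lemma sum_runAfter_tied_le {a : ℕ} (ha : 1 ≤ a) (han : 4 * a + 16 ≤ n) (s : ZMod n) :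
    ∑ x : ZMod n → Bool, (if RunAfter a s x ∧ Tied (a + 1) x ∧ Tied (a + 2) x ∧ Tied (a + 3) x
      then (1 : ℝ) else 0) ≤ 2 ^ n * (2 ^ 16 * (√(2 ^ a) / (√n * n))) := by
  set U : Finset (ZMod n) := (range (n - (2 * a + 8))).image
    fun i => s + ((a + 2 + i : ℕ) : ZMod n) with hU
  have hUc : U.card = n - (2 * a + 8) := by
    rw [hU, card_image_of_injOn, card_range]
    intro i hi j hj e
    simp only [coe_range, Set.mem_Iio] at hi hj
    have h2 := congrArg (fun t : ZMod n => (t - s).val) e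
    simp only at h2
    rw [val_natCast_sub s (by omega), val_natCast_sub s (by omega)] at h2
    omega
  have hmain := sum_tied_three_sq_le ha (by omega) U (E := RunAfter a s)
    (fun L h1 h2 => runAfter_flipAt h1 h2 s)
    (fun p w hw t ht x => by
      obtain ⟨i, hi, rfl⟩ := mem_image.1 ht
      exact runAfter_overwrite s p hw (mem_range.1 hi) x)
  have hE := sum_runAfter_le (n := n) (a := a) (by omega) s
  set T := ∑ x : ZMod n → Bool, (if RunAfter a s x ∧ Tied (a + 1) x ∧ Tied (a + 2) x ∧
    Tied (a + 3) x then (1 : ℝ) else 0) with hT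
  set R := ∑ x : ZMod n → Bool, (if RunAfter a s x then (1 : ℝ) else 0) with hR
  have hR0 : 0 ≤ R := sum_nonneg fun x _ => by split_ifs <;> simp
  have hn : (0 : ℝ) < n := by exact_mod_cast NeZero.pos n
  have hUn : (n : ℝ) ≤ 2 * U.card := by
    rw [hUc]
    have : n ≤ 2 * (n - (2 * a + 8)) := by omega
    exact_mod_cast this
  have h3 : (n : ℝ) ^ 3 * T ^ 2 ≤ 2 ^ (a + 31) * (2 ^ n) ^ 2 := by
    have e1 : (n : ℝ) ^ 3 * T ^ 2 ≤ 8 * (U.card ^ 3 * T ^ 2) := by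
      have : (n : ℝ) ^ 3 ≤ (2 * U.card) ^ 3 := pow_le_pow_left₀ hn.le hUn 3
      nlinarith [sq_nonneg T]
    have e2 : (2 ^ a * R) ^ 2 ≤ (2 * 2 ^ n) ^ 2 := pow_le_pow_left₀ (by positivity) hE 2
    calc (n : ℝ) ^ 3 * T ^ 2 ≤ 8 * (2 ^ (3 * a + 26) * R ^ 2) := by linarith
      _ = 2 ^ (a + 29) * (2 ^ a * R) ^ 2 := by ring
      _ ≤ 2 ^ (a + 29) * (2 * 2 ^ n) ^ 2 := mul_le_mul_of_nonneg_left e2 (by positivity)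
      _ = _ := by ring
  have h4 : T ^ 2 ≤ (2 ^ n * (2 ^ 16 * (√(2 ^ a) / (√n * n)))) ^ 2 := by
    rw [mul_pow, mul_pow, div_pow, mul_pow, Real.sq_sqrt (by positivity), Real.sq_sqrt hn.le,
      ← mul_div_assoc, ← mul_div_assoc, le_div_iff₀ (by positivity)]
    have : (2 : ℝ) ^ (a + 31) * (2 ^ n) ^ 2 ≤ (2 ^ n) ^ 2 * ((2 ^ 16) ^ 2 * 2 ^ a) := by
      have h0 : (0 : ℝ) ≤ (2 ^ n) ^ 2 * 2 ^ a := by positivity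
      rw [pow_add]
      nlinarith
    calc T ^ 2 * ((n : ℝ) * n ^ 2) = (n : ℝ) ^ 3 * T ^ 2 := by ring
      _ ≤ _ := h3.trans this
  exact (pow_le_pow_iff_left₀ (sum_nonneg fun x _ => by split_ifs <;> simp) (by positivity)
    two_ne_zero).1 h4

/-- The letter at `i` belongs to or delimits a run of `x` above whose length all levels are tied. -/
def Critical (i : ZMod n) (x : ZMod n → Bool) : Prop :=
  ∃ ℓ, 1 ≤ ℓ ∧ (∃ c, ∃ s : ZMod n, ∃ j : ℕ, j < ℓ + 2 ∧ i = s + (j : ZMod n) ∧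
    Matches (runPattern c ℓ) (ℓ + 2) x s) ∧ ∀ ℓ' > ℓ, ℓ' < n → Tied ℓ' x

lemma critical_or_const {A : ℕ} (hA : A + 2 < n) {i : ZMod n} {x : ZMod n → Bool}
    (h : Critical i x ∨ ∃ c, ∀ t, x t = c) :
    (∃ a ∈ Ico 1 A, ∃ j ∈ range (a + 2), RunAfter a (i - (j : ZMod n)) x ∧
      Tied (a + 1) x ∧ Tied (a + 2) x ∧ Tied (a + 3) x) ∨
    ∃ j ∈ range (A + 2), ∃ c, Matches (fun _ => c) A x (i + 1 - (j : ZMod n)) := by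
  rcases h with ⟨ℓ, hℓ, ⟨c, s, j, hj, rfl, hm⟩, ht⟩ | ⟨c, hc⟩
  · rcases lt_or_ge ℓ A with hlt | hge
    · refine Or.inl ⟨ℓ, mem_Ico.2 ⟨hℓ, hlt⟩, j, mem_range.2 hj, Or.inr ⟨c, ?_⟩,
        ht _ (by omega) (by omega), ht _ (by omega) (by omega), ht _ (by omega) (by omega)⟩
      simpa using hm
    -- A window of A letters inside the long run is slid towards `i` as far as the run allows,
    -- leaving only A + 2 relative positions.
    · refine Or.inr ⟨j - min j (ℓ - A), mem_range.2 (by omega), c, ?_⟩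
      intro k hk
      have := hm (1 + min j (ℓ - A) + k) (by omega)
      rw [runPattern, if_neg (by omega)] at this
      rw [← this]
      congr 1
      rw [Nat.cast_sub (by omega)]
      push_cast
      ring
  · exact Or.inr ⟨0, by simp, c, fun k _ => hc _⟩

lemma sum_sqrt_two_pow_le (A : ℕ) : ∑ a ∈ range A, √((2 : ℝ) ^ a) ≤ 3 * √(2 ^ A) := by
  induction A with
  | zero => simp
  | succ A ih =>
    rw [sum_range_succ, pow_succ, Real.sqrt_mul (by positivity)]
    have h : (4 : ℝ) / 3 ≤ √2 := Real.le_sqrt_of_sq_le (by norm_num)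
    nlinarith [Real.sqrt_nonneg ((2 : ℝ) ^ A)]

open Classical in
-- Union bound with cutoff A near log₂ n. For a < A there are at most A + 1 relative positions, and
-- the geometric sum of 2^{a/2} is absorbed by √n. From A on, a constant window of A letters
-- suffices, with probability at most 4/n at each position.
lemma sum_critical_le {A : ℕ} (hA : 1 ≤ A) (hAn : 4 * A + 16 ≤ n) (h1 : 2 ^ A ≤ n)
    (h2 : n ≤ 2 ^ (A + 1)) (i : ZMod n) :
    ∑ x : ZMod n → Bool, (if Critical i x ∨ ∃ c, ∀ t, x t = c then (1 : ℝ) else 0)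
      ≤ 2 ^ n * (2 ^ 19 * (A / n)) := by
  have hn : (0 : ℝ) < n := by exact_mod_cast NeZero.pos n
  have hsn : (0 : ℝ) < √n := Real.sqrt_pos.2 hn
  have h1' : (2 : ℝ) ^ A ≤ n := by exact_mod_cast h1
  have h2' : (n : ℝ) ≤ 2 * 2 ^ A := by
    have : (n : ℝ) ≤ 2 ^ (A + 1) := by exact_mod_cast h2
    rw [pow_succ] at this; linarith
  have hA' : (1 : ℝ) ≤ A := by exact_mod_cast hA
  have hpt : ∀ x : ZMod n → Bool, (if Critical i x ∨ ∃ c, ∀ t, x t = c then (1 : ℝ) else 0) ≤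
      (∑ a ∈ Ico 1 A, ∑ j ∈ range (a + 2), if RunAfter a (i - (j : ZMod n)) x ∧
        Tied (a + 1) x ∧ Tied (a + 2) x ∧ Tied (a + 3) x then (1 : ℝ) else 0) +
      ∑ j ∈ range (A + 2), if ∃ c, Matches (fun _ => c) A x (i + 1 - (j : ZMod n))
        then (1 : ℝ) else 0 := by
    intro x
    have nn1 : ∀ a ∈ Ico 1 A, (0 : ℝ) ≤ ∑ j ∈ range (a + 2), if RunAfter a (i - (j : ZMod n)) x ∧
        Tied (a + 1) x ∧ Tied (a + 2) x ∧ Tied (a + 3) x then (1 : ℝ) else 0 :=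
      fun a _ => sum_nonneg fun j _ => by split_ifs <;> simp
    have nn2 : (0 : ℝ) ≤ ∑ j ∈ range (A + 2),
        if ∃ c, Matches (fun _ => c) A x (i + 1 - (j : ZMod n)) then (1 : ℝ) else 0 :=
      sum_nonneg fun j _ => by split_ifs <;> simp
    split_ifs with h
    · rcases critical_or_const (A := A) (by omega) h with ⟨a, ha, j, hj, hh⟩ | ⟨j, hj, hh⟩
      · have b1 := single_le_sum nn1 ha
        have b2 : (if RunAfter a (i - (j : ZMod n)) x ∧
            Tied (a + 1) x ∧ Tied (a + 2) x ∧ Tied (a + 3) x then (1 : ℝ) else 0) ≤ _ :=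
          single_le_sum (f := fun j : ℕ => if RunAfter a (i - (j : ZMod n)) x ∧
            Tied (a + 1) x ∧ Tied (a + 2) x ∧ Tied (a + 3) x then (1 : ℝ) else 0)
            (fun j _ => by split_ifs <;> simp) hj
        rw [if_pos hh] at b2
        linarith
      · have b2 : (if ∃ c, Matches (fun _ => c) A x (i + 1 - (j : ZMod n)) then (1 : ℝ) else 0) ≤ _ :=
          single_le_sum (f := fun j : ℕ => if ∃ c, Matches (fun _ => c) A x (i + 1 - (j : ZMod n))
            then (1 : ℝ) else 0)
            (fun j _ => by split_ifs <;> simp) hj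
        rw [if_pos hh] at b2
        have := sum_nonneg nn1
        linarith
    · exact add_nonneg (sum_nonneg nn1) nn2
  have hshort : ∑ x : ZMod n → Bool, (∑ a ∈ Ico 1 A, ∑ j ∈ range (a + 2),
      if RunAfter a (i - (j : ZMod n)) x ∧
        Tied (a + 1) x ∧ Tied (a + 2) x ∧ Tied (a + 3) x then (1 : ℝ) else 0)
      ≤ 2 ^ n * (2 ^ 16 * (3 * ((A + 1) / n))) := by
    rw [sum_comm]
    calc _ ≤ ∑ a ∈ Ico 1 A, 2 ^ n * (2 ^ 16 * (√(2 ^ a) / (√n * n))) * (A + 1) := by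
          refine sum_le_sum fun a ha => ?_
          rw [mem_Ico] at ha
          rw [sum_comm]
          calc _ ≤ ∑ j ∈ range (a + 2), 2 ^ n * (2 ^ 16 * (√(2 ^ a) / (√n * n))) :=
                sum_le_sum fun j _ => sum_runAfter_tied_le ha.1 (by omega) _
            _ = 2 ^ n * (2 ^ 16 * (√(2 ^ a) / (√n * n))) * (a + 2) := by
                rw [sum_const, card_range, nsmul_eq_mul]; push_cast; ring
            _ ≤ _ := by
                have : (a : ℝ) + 2 ≤ A + 1 := by
                  have : a + 2 ≤ A + 1 := by omega
                  exact_mod_cast this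
                exact mul_le_mul_of_nonneg_left this (by positivity)
      _ ≤ ∑ a ∈ range A, 2 ^ n * (2 ^ 16 * (√(2 ^ a) / (√n * n))) * (A + 1) := by
          refine sum_le_sum_of_subset_of_nonneg ?_ fun a _ _ => by positivity
          intro a ha
          rw [mem_Ico] at ha
          exact mem_range.2 ha.2
      _ = 2 ^ n * (2 ^ 16 * ((∑ a ∈ range A, √((2 : ℝ) ^ a)) / √n * ((A + 1) / n))) := by
          rw [sum_div, sum_mul, mul_sum, mul_sum]
          refine sum_congr rfl fun a _ => ?_
          field_simp
      _ ≤ _ := by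
          have : (∑ a ∈ range A, √((2 : ℝ) ^ a)) / √n ≤ 3 := by
            rw [div_le_iff₀ hsn]
            exact (sum_sqrt_two_pow_le A).trans
              (mul_le_mul_of_nonneg_left (Real.sqrt_le_sqrt h1') (by norm_num))
          gcongr
  have hlong : ∑ x : ZMod n → Bool, (∑ j ∈ range (A + 2),
      if ∃ c, Matches (fun _ => c) A x (i + 1 - (j : ZMod n)) then (1 : ℝ) else 0)
      ≤ 2 ^ n * (4 * ((A + 2) / n)) := by
    rw [sum_comm]
    calc _ ≤ ∑ j ∈ range (A + 2), 2 ^ n * (4 / (n : ℝ)) := by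
          refine sum_le_sum fun j _ => ?_
          have := sum_exists_matches_le (n := n) (p := fun c _ => c) (w := A) (by omega)
            (i + 1 - (j : ZMod n))
          rw [← mul_div_assoc, le_div_iff₀ hn]
          set Q := ∑ x : ZMod n → Bool, (if ∃ c, Matches (fun _ => c) A x (i + 1 - (j : ZMod n))
            then (1 : ℝ) else 0)
          have hQ : 0 ≤ Q := sum_nonneg fun x _ => by split_ifs <;> simp
          nlinarith
      _ = _ := by
          rw [sum_const, card_range, nsmul_eq_mul]; push_cast; field_simp
  calc _ ≤ _ := sum_le_sum fun x _ => hpt x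
    _ ≤ 2 ^ n * (2 ^ 16 * (3 * ((A + 1) / n))) + 2 ^ n * (4 * ((A + 2) / n)) := by
        rw [sum_add_distrib]
        exact add_le_add hshort hlong
    _ = 2 ^ n * ((2 ^ 16 * (3 * (A + 1)) + 4 * (A + 2)) / n) := by ring
    _ ≤ 2 ^ n * ((2 ^ 19 * A) / n) := by
        gcongr
        linarith
    _ = _ := by ring

end Probability

/-! ### Lexicographic comparison through multiplicities -/

section Lex

/-- In non-increasing lists, equal multiplicities above m make the lists agree until the entries m
of one are used up. There the other list is larger, also when the first one simply ends. -/
lemma lt_of_count_lt {m : ℕ} : ∀ {z u : List ℕ}, z.Pairwise (· ≥ ·) → u.Pairwise (· ≥ ·) →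
    z.count m < u.count m → (∀ m' > m, z.count m' = u.count m') → z < u
  | _, [], _, _, h, _ => by simp at h
  | [], b :: u, _, _, _, _ => List.nil_lt_cons b u
  | a :: z, b :: u, hz, hu, h, hab => by
    rw [List.cons_lt_cons_iff]
    rw [List.pairwise_cons] at hz hu
    rcases lt_trichotomy a b with hlt | heq | hgt
    · exact Or.inl hlt
    · subst heq
      refine Or.inr ⟨rfl, lt_of_count_lt hz.2 hu.2 (m := m) ?_ fun m' hm' => ?_⟩
      · simpa [List.count_cons] using h
      · simpa [List.count_cons] using hab m' hm'
    · exfalso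
      have h0 : ∀ k ≥ a, (b :: u).count k = 0 := by
        intro k hk
        rw [List.count_eq_zero, List.mem_cons]
        rintro (rfl | hmem)
        · omega
        · have := hu.1 k hmem; omega
      have h1 : 0 < (a :: z).count a := List.count_pos_iff.2 (by simp)
      rcases le_or_gt a m with ham | ham
      · rw [h0 m ham] at h; omega
      · rw [hab a ham, h0 a le_rfl] at h1; omega

lemma exists_last {P : ℕ → Prop} {N : ℕ} (hN : ∀ k > N, ¬ P k) (h : ∃ k, P k) :
    ∃ k, P k ∧ ∀ k' > k, ¬ P k' := by
  classical
  obtain ⟨k, hk⟩ := h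
  have hkN : k ≤ N := by by_contra hlt; exact hN k (by omega) hk
  refine ⟨Nat.findGreatest P N, Nat.findGreatest_spec hkN hk, fun k' hk' hP => ?_⟩
  have : k' ≤ N := by by_contra hlt; exact hN k' (by omega) hP
  exact Nat.findGreatest_is_greatest hk' this hP

/-- If the comparison of two non-increasing lists changes, then the multiplicity of some entry
changes, above which the multiplicities in the compared lists agree. -/
lemma exists_count_change {u z u' z' : List ℕ} {N : ℕ} (hu : u.Pairwise (· ≥ ·))
    (hz : z.Pairwise (· ≥ ·)) (hu' : u'.Pairwise (· ≥ ·)) (hz' : z'.Pairwise (· ≥ ·))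
    (hN : ∀ k > N, u.count k = 0 ∧ z.count k = 0 ∧ u'.count k = 0 ∧ z'.count k = 0)
    (h : ¬ (z < u ↔ z' < u')) :
    ∃ ℓ, (u.count ℓ ≠ u'.count ℓ ∨ z.count ℓ ≠ z'.count ℓ) ∧
      ∀ k > ℓ, u.count k = z.count k ∧ u'.count k = z'.count k := by
  have hex : ∃ ℓ, u.count ℓ ≠ u'.count ℓ ∨ z.count ℓ ≠ z'.count ℓ := by
    by_contra hcon
    push Not at hcon
    have e1 : u = u' := (List.perm_iff_count.2 fun a => (hcon a).1).eq_of_pairwise'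
      hu hu'
    have e2 : z = z' := (List.perm_iff_count.2 fun a => (hcon a).2).eq_of_pairwise'
      hz hz'
    exact h (by rw [e1, e2])
  obtain ⟨ℓ, hℓ, hmax⟩ := exists_last (N := N) (fun k hk => by
    have := hN k hk; omega) hex
  have hsame : ∀ k > ℓ, u.count k = u'.count k ∧ z.count k = z'.count k := fun k hk => by
    have := hmax k hk; omega
  refine ⟨ℓ, hℓ, ?_⟩
  by_contra hcon
  have hex2 : ∃ k, k > ℓ ∧ u.count k ≠ z.count k := by
    by_contra hc
    push Not at hc
    refine hcon fun k hk => ⟨hc k hk, ?_⟩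
    have := hc k hk
    have := hsame k hk
    omega
  -- The largest untied level above ℓ decides both comparisons. Multiplicities there are unchanged,
  -- so the outcomes agree, a contradiction.
  obtain ⟨k, ⟨hk, hne⟩, hkmax⟩ := exists_last (N := N) (fun k hk => by
    have := hN k hk; omega) hex2
  have htop : ∀ m > k, z.count m = u.count m ∧ z'.count m = u'.count m := fun m hm => by
    have h1 := hkmax m hm
    have h2 := hsame m (by omega)
    have : u.count m = z.count m := by by_contra hh; exact h1 ⟨by omega, hh⟩
    omega
  have hs := hsame k hk
  rcases lt_or_gt_of_ne hne with hlt | hgt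
  · have a1 : u < z := lt_of_count_lt hu hz hlt fun m hm => (htop m hm).1.symm
    have a2 : u' < z' := lt_of_count_lt hu' hz' (m := k) (by omega) fun m hm => (htop m hm).2.symm
    exact h ⟨fun h' => (lt_asymm a1 h').elim, fun h' => (lt_asymm a2 h').elim⟩
  · have a1 : z < u := lt_of_count_lt hz hu hgt fun m hm => (htop m hm).1
    have a2 : z' < u' := lt_of_count_lt hz' hu' (m := k) (by omega) fun m hm => (htop m hm).2
    exact h ⟨fun _ => a2, fun _ => a1⟩

end Lex

/-! ### Runs of sets as patterns in words -/

section Runs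

variable {r : ℕ}

/-- The residues modulo `2 * r + 1` as the points of the circle. -/
def cyc (r : ℕ) : ZMod (2 * r + 1) ≃ Fin (2 * r + 1) := Equiv.refl _

lemma cyc_add (a b : ZMod (2 * r + 1)) : cyc r (a + b) = cyc r a + cyc r b := rfl

lemma cyc_natCast (j : ℕ) : cyc r (j : ZMod (2 * r + 1)) = Fin.ofNat (2 * r + 1) j :=
  Fin.ext (ZMod.val_natCast (2 * r + 1) j)

/-- The cyclic indicator word of a set. -/
def word (S : Finset (Fin (2 * r + 1))) : ZMod (2 * r + 1) → Bool :=
  fun t => decide (cyc r t ∈ S)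

lemma word_eq_true {S : Finset (Fin (2 * r + 1))} {t : ZMod (2 * r + 1)} :
    word S t = true ↔ cyc r t ∈ S := by simp [word]

lemma word_compl (S : Finset (Fin (2 * r + 1))) (t : ZMod (2 * r + 1)) :
    word Sᶜ t = !word S t := by simp [word]

lemma mem_arc {a t : ZMod (2 * r + 1)} {ℓ : ℕ} :
    cyc r t ∈ arc (cyc r a) ℓ ↔ ∃ j < ℓ, t = a + (j : ZMod (2 * r + 1)) := by
  simp only [arc, mem_image, mem_range, ← cyc_natCast, ← cyc_add, (cyc r).apply_eq_iff_eq,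
    eq_comm (a := t)]

lemma mem_arc_iff_val {a t : ZMod (2 * r + 1)} {ℓ : ℕ} :
    cyc r t ∈ arc (cyc r a) ℓ ↔ (t - a).val < ℓ := by
  rw [mem_arc]
  constructor
  · rintro ⟨j, hj, rfl⟩
    rw [add_sub_cancel_left, ZMod.val_natCast]
    exact (Nat.mod_le _ _).trans_lt hj
  · intro h
    exact ⟨_, h, eq_add_val a t⟩

lemma card_arc {a : ZMod (2 * r + 1)} {ℓ : ℕ} (hℓ : ℓ ≤ 2 * r + 1) :
    (arc (cyc r a) ℓ).card = ℓ := by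
  unfold arc
  rw [card_image_of_injOn, card_range]
  intro i hi j hj e
  simp only [coe_range, Set.mem_Iio] at hi hj
  have := congrArg Fin.val (add_left_cancel e)
  simp only [Fin.val_ofNat] at this
  rwa [Nat.mod_eq_of_lt (by omega), Nat.mod_eq_of_lt (by omega)] at this

lemma arc_eq_univ {a : ZMod (2 * r + 1)} {ℓ : ℕ} (hℓ : 2 * r + 1 ≤ ℓ) :
    arc (cyc r a) ℓ = univ := by
  ext t
  obtain ⟨t, rfl⟩ := (cyc r).surjective t
  simp only [mem_univ, iff_true]
  exact mem_arc_iff_val.2 ((ZMod.val_lt _).trans_le hℓ)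

lemma arc_subset_iff {S : Finset (Fin (2 * r + 1))} {a : ZMod (2 * r + 1)} {ℓ : ℕ} :
    arc (cyc r a) ℓ ⊆ S ↔ ∀ j < ℓ, word S (a + (j : ZMod (2 * r + 1))) = true := by
  constructor
  · intro h j hj
    exact word_eq_true.2 (h (mem_arc.2 ⟨j, hj, rfl⟩))
  · intro h t ht
    obtain ⟨t, rfl⟩ := (cyc r).surjective t
    obtain ⟨j, hj, rfl⟩ := mem_arc.1 ht
    exact word_eq_true.1 (h j hj)

lemma arc_nonempty (a : ZMod (2 * r + 1)) {ℓ : ℕ} (hℓ : 1 ≤ ℓ) : (arc (cyc r a) ℓ).Nonempty :=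
  ⟨cyc r a, mem_arc.2 ⟨0, hℓ, by simp⟩⟩

/-- The runs of length `ℓ` are the arcs of length `ℓ` in `S` whose two neighbours are not in `S`. -/
lemma matches_runPattern_true_iff {x : ZMod (2 * r + 1) → Bool} {s : ZMod (2 * r + 1)} {ℓ : ℕ} :
    Matches (runPattern true ℓ) (ℓ + 2) x s ↔ x s = false ∧
      (∀ j < ℓ, x (s + 1 + (j : ZMod (2 * r + 1))) = true) ∧
      x (s + 1 + (ℓ : ZMod (2 * r + 1))) = false := by
  constructor
  · intro h
    refine ⟨by simpa [runPattern] using h 0 (by omega), fun j hj => ?_, ?_⟩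
    · have := h (j + 1) (by omega)
      rw [runPattern, if_neg (by omega)] at this
      rw [← this]; congr 1; push_cast; ring
    · have := h (ℓ + 1) (by omega)
      rw [runPattern, if_pos (by omega)] at this
      simp only [Bool.not_true] at this
      rw [← this]; congr 1; push_cast; ring
  · rintro ⟨h0, h1, h2⟩ j hj
    rcases Nat.eq_zero_or_pos j with rfl | hpos
    · simpa [runPattern] using h0
    · obtain ⟨k, rfl⟩ : ∃ k, j = k + 1 := ⟨j - 1, by omega⟩
      have e : s + ((k + 1 : ℕ) : ZMod (2 * r + 1)) = s + 1 + (k : ZMod (2 * r + 1)) := by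
        push_cast; ring
      rw [e]
      rcases Nat.lt_or_ge k ℓ with hk | hk
      · rw [h1 k hk, runPattern, if_neg (by omega)]
      · have : k = ℓ := by omega
        subst this
        rw [h2, runPattern, if_pos (by omega)]; rfl

lemma isRun_arc {S : Finset (Fin (2 * r + 1))} {s : ZMod (2 * r + 1)} {ℓ : ℕ} (hℓ : 1 ≤ ℓ)
    (h : Matches (runPattern true ℓ) (ℓ + 2) (word S) s) :
    IsRun S (arc (cyc r (s + 1)) ℓ) := by
  obtain ⟨h0, h1, h2⟩ := matches_runPattern_true_iff.1 h
  refine ⟨⟨arc_nonempty _ hℓ, arc_subset_iff.2 h1, _, _, rfl⟩, ?_⟩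
  rintro B ⟨-, hBS, b, m, rfl⟩ hsub
  obtain ⟨b, rfl⟩ := (cyc r).surjective b
  have hB := arc_subset_iff.1 hBS
  have hmem : cyc r (s + 1) ∈ arc (cyc r b) m :=
    hsub (mem_arc.2 ⟨0, hℓ, by simp⟩)
  obtain ⟨j, hj, e⟩ := mem_arc.1 hmem
  -- Otherwise the larger arc would also contain the position `s`, which delimits the run.
  have hj0 : j = 0 := by
    by_contra hne
    have := hB (j - 1) (by omega)
    have e2 : b + ((j - 1 : ℕ) : ZMod (2 * r + 1)) = s := by
      rw [Nat.cast_sub (by omega)]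
      push_cast
      linear_combination -e
    rw [e2, h0] at this
    simp at this
  subst hj0
  have hb : b = s + 1 := by rw [e]; simp
  have hm : m ≤ ℓ := by
    by_contra hlt
    have := hB ℓ (by omega)
    rw [hb, h2] at this
    simp at this
  intro t ht
  obtain ⟨t, rfl⟩ := (cyc r).surjective t
  obtain ⟨k, hk, ek⟩ := mem_arc.1 ht
  exact mem_arc.2 ⟨k, by omega, by rw [ek, hb]⟩

lemma exists_arc_of_isRun {S A : Finset (Fin (2 * r + 1))} (h : IsRun S A)
    (hA : A.card < 2 * r + 1) :
    ∃ s, A = arc (cyc r (s + 1)) A.card ∧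
      Matches (runPattern true A.card) (A.card + 2) (word S) s := by
  obtain ⟨⟨hne, hAS, a, m, rfl⟩, hmax⟩ := h
  obtain ⟨a', rfl⟩ := (cyc r).surjective a
  have hm : m < 2 * r + 1 := by
    by_contra hge
    rw [arc_eq_univ (by omega)] at hA
    simp at hA
  have hcard : (arc (cyc r a') m).card = m := card_arc hm.le
  rw [hcard]
  have hsub := arc_subset_iff.1 hAS
  refine ⟨a' - 1, ?_, matches_runPattern_true_iff.2 ⟨?_, ?_, ?_⟩⟩
  · have : a' - 1 + 1 = a' := by ring
    rw [this]
  · by_contra hx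
    rw [Bool.not_eq_false] at hx
    have hbig : arc (cyc r (a' - 1)) (m + 1) ⊆ S := by
      rw [arc_subset_iff]
      intro j hj
      rcases Nat.eq_zero_or_pos j with rfl | hpos
      · simpa using hx
      · have := hsub (j - 1) (by omega)
        rw [← this]
        congr 1
        rw [Nat.cast_sub (by omega)]; push_cast; ring
    have := hmax (y := arc (cyc r (a' - 1)) (m + 1))
      ⟨arc_nonempty _ (by omega), hbig, _, _, rfl⟩ (by
        intro t ht
        obtain ⟨t, rfl⟩ := (cyc r).surjective t
        obtain ⟨j, hj, e⟩ := mem_arc.1 ht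
        exact mem_arc.2 ⟨j + 1, by omega, by rw [e]; push_cast; ring⟩)
    have := card_le_card this
    rw [card_arc (by omega), hcard] at this
    omega
  · intro j hj
    have : a' - 1 + 1 = a' := by ring
    rw [this]
    exact hsub j hj
  · have e1 : a' - 1 + 1 = a' := by ring
    rw [e1]
    by_contra hx
    rw [Bool.not_eq_false] at hx
    have hbig : arc (cyc r a') (m + 1) ⊆ S := by
      rw [arc_subset_iff]
      intro j hj
      rcases Nat.lt_or_ge j m with h | h
      · exact hsub j h
      · rw [show j = m by omega]; exact hx
    have := hmax (y := arc (cyc r a') (m + 1))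
      ⟨arc_nonempty _ (by omega), hbig, _, _, rfl⟩ (by
        intro t ht
        obtain ⟨t, rfl⟩ := (cyc r).surjective t
        obtain ⟨j, hj, e⟩ := mem_arc.1 ht
        exact mem_arc.2 ⟨j, by omega, e⟩)
    have := card_le_card this
    rw [card_arc (by omega), hcard] at this
    omega

lemma count_runLengths (S : Finset (Fin (2 * r + 1))) (ℓ : ℕ) :
    (runLengths S).count ℓ = ((runs S).filter fun A => ℓ = A.card).card := by
  rw [runLengths, ← Multiset.coe_count, Multiset.sort_eq, Multiset.count_map]
  rfl

lemma mem_runs {S A : Finset (Fin (2 * r + 1))} : A ∈ runs S ↔ IsRun S A := by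
  simp [runs]

/-- The full circle has no delimiters and is excluded. For ℓ = 2r the two delimiters are the same
letter, and the pattern still describes the run. -/
lemma count_runLengths_eq_card_runSites (S : Finset (Fin (2 * r + 1))) {ℓ : ℕ} (hℓ : 1 ≤ ℓ)
    (hℓn : ℓ < 2 * r + 1) :
    (runLengths S).count ℓ = (runSites true ℓ (word S)).card := by
  rw [count_runLengths]
  symm
  refine card_bij (fun s _ => arc (cyc r (s + 1)) ℓ) ?_ ?_ ?_
  · intro s hs
    rw [mem_filter, mem_runs]
    exact ⟨isRun_arc hℓ (mem_runSites.1 hs), (card_arc hℓn.le).symm⟩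
  · intro s hs t ht e
    obtain ⟨h0, -, -⟩ := matches_runPattern_true_iff.1 (mem_runSites.1 hs)
    obtain ⟨-, h1, -⟩ := matches_runPattern_true_iff.1 (mem_runSites.1 ht)
    have hmem : cyc r (s + 1) ∈
        arc (cyc r (t + 1)) ℓ := by
      rw [← e]; exact mem_arc.2 ⟨0, hℓ, by simp⟩
    obtain ⟨j, hj, ej⟩ := mem_arc.1 hmem
    rcases Nat.eq_zero_or_pos j with rfl | hpos
    · simpa using ej
    · have := h1 (j - 1) (by omega)
      have e2 : t + 1 + ((j - 1 : ℕ) : ZMod (2 * r + 1)) = s := by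
        rw [Nat.cast_sub (by omega)]; push_cast; linear_combination -ej
      rw [e2, h0] at this
      simp at this
  · intro A hA
    rw [mem_filter, mem_runs] at hA
    obtain ⟨s, hs, hm⟩ := exists_arc_of_isRun hA.1 (by omega)
    rw [← hA.2] at hs hm
    exact ⟨s, mem_runSites.2 hm, hs.symm⟩

lemma runSites_word_compl (S : Finset (Fin (2 * r + 1))) (ℓ : ℕ) :
    runSites true ℓ (word Sᶜ) = runSites false ℓ (word S) := by
  ext s
  rw [mem_runSites, mem_runSites]
  refine forall₂_congr fun j hj => ?_
  rw [word_compl, runPattern, runPattern]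
  cases word S (s + j) <;> split_ifs <;> simp

lemma count_runLengths_zero (S : Finset (Fin (2 * r + 1))) : (runLengths S).count 0 = 0 := by
  rw [count_runLengths, card_eq_zero, filter_eq_empty_iff]
  intro A hA h
  have := (mem_runs.1 hA).1.1
  rw [← card_pos] at this
  omega

lemma eq_univ_of_count_runLengths {S : Finset (Fin (2 * r + 1))} {ℓ : ℕ} (hℓ : 2 * r + 1 ≤ ℓ)
    (h : (runLengths S).count ℓ ≠ 0) : S = univ ∧ ℓ = 2 * r + 1 := by
  rw [count_runLengths, card_ne_zero] at h
  obtain ⟨A, hA⟩ := h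
  rw [mem_filter, mem_runs] at hA
  have h1 : A.card ≤ 2 * r + 1 := by simpa using card_le_univ A
  have h2 : A = univ := by
    rw [← card_eq_iff_eq_univ, Fintype.card_fin]; omega
  refine ⟨univ_subset_iff.1 (h2 ▸ hA.1.1.2.1), by omega⟩

lemma pairwise_runLengths (S : Finset (Fin (2 * r + 1))) :
    (runLengths S).Pairwise (· ≥ ·) := Multiset.pairwise_sort _ _

lemma critical_of_runSites_ne {x y : ZMod (2 * r + 1) → Bool} {i : ZMod (2 * r + 1)}
    (hxy : ∀ t ≠ i, x t = y t) {ℓ : ℕ} (hℓ : 1 ≤ ℓ) {c : Bool}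
    (h : runSites c ℓ x ≠ runSites c ℓ y)
    (hx : ∀ k > ℓ, k < 2 * r + 1 → Tied k x) (hy : ∀ k > ℓ, k < 2 * r + 1 → Tied k y) :
    Critical i x ∨ Critical i y := by
  have key : ∀ {x y : ZMod (2 * r + 1) → Bool}, (∀ t ≠ i, x t = y t) →
      (∀ k > ℓ, k < 2 * r + 1 → Tied k x) → ∀ s ∈ runSites c ℓ x, s ∉ runSites c ℓ y →
      Critical i x := by
    intro x y hxy hx s hs hs'
    rw [mem_runSites] at hs hs'
    have : ∃ j < ℓ + 2, x (s + (j : ZMod (2 * r + 1))) ≠ y (s + (j : ZMod (2 * r + 1))) := by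
      by_contra hcon
      push Not at hcon
      exact hs' fun j hj => by rw [← hcon j hj, hs j hj]
    obtain ⟨j, hj, hne⟩ := this
    refine ⟨ℓ, hℓ, ⟨c, s, j, hj, ?_, hs⟩, hx⟩
    by_contra hi
    exact hne (hxy _ fun h => hi h.symm)
  by_contra hcon
  push Not at hcon
  refine h (Subset.antisymm (fun s hs => ?_) fun s hs => ?_)
  · by_contra hs'
    exact hcon.1 (key hxy hx s hs hs')
  · by_contra hs'
    exact hcon.2 (key (fun t ht => (hxy t ht).symm) hy s hs hs')

/-- A coordinate that changes the membership in the family is critical before or after. -/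
lemma critical_of_mem_family_ne {S T : Finset (Fin (2 * r + 1))} {i : ZMod (2 * r + 1)}
    (hST : ∀ t ≠ i, word S t = word T t) (h : ¬ (S ∈ family r ↔ T ∈ family r)) :
    (Critical i (word S) ∨ ∃ c, ∀ t, word S t = c) ∨
      (Critical i (word T) ∨ ∃ c, ∀ t, word T t = c) := by
  simp only [family, mem_filter, mem_univ, true_and] at h
  have hbig : ∀ S : Finset (Fin (2 * r + 1)), ∀ k > 2 * r + 1, (runLengths S).count k = 0 := by
    intro S k hk
    by_contra hne
    have := (eq_univ_of_count_runLengths hk.le hne).2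
    omega
  obtain ⟨ℓ, hne, hab⟩ := exists_count_change (pairwise_runLengths S) (pairwise_runLengths Sᶜ)
    (pairwise_runLengths T) (pairwise_runLengths Tᶜ) (N := 2 * r + 1)
    (fun k hk => ⟨hbig _ k hk, hbig _ k hk, hbig _ k hk, hbig _ k hk⟩) h
  have hS1 : 1 ≤ ℓ := by
    by_contra h0
    have : ℓ = 0 := by omega
    subst this
    simp [count_runLengths_zero] at hne
  rcases Nat.lt_or_ge ℓ (2 * r + 1) with hlt | hge
  · have hcount := fun S : Finset (Fin (2 * r + 1)) => count_runLengths_eq_card_runSites S hS1 hlt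
    have tie : ∀ k > ℓ, k < 2 * r + 1 → Tied k (word S) ∧ Tied k (word T) := by
      intro k hk hkn
      have := hab k hk
      simp only [count_runLengths_eq_card_runSites _ (show 1 ≤ k by omega) hkn,
        runSites_word_compl] at this
      exact this
    have hc : ∃ c, runSites c ℓ (word S) ≠ runSites c ℓ (word T) := by
      simp only [hcount, runSites_word_compl] at hne
      rcases hne with hne | hne
      · exact ⟨true, fun e => hne (by rw [e])⟩
      · exact ⟨false, fun e => hne (by rw [e])⟩
    obtain ⟨c, hc⟩ := hc
    rcases critical_of_runSites_ne hST hS1 hc (fun k h1 h2 => (tie k h1 h2).1)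
      (fun k h1 h2 => (tie k h1 h2).2) with h | h
    · exact Or.inl (Or.inl h)
    · exact Or.inr (Or.inl h)
  -- A run as long as the circle occurs only in a constant word.
  · have huniv : ∀ S : Finset (Fin (2 * r + 1)), (runLengths S).count ℓ ≠ 0 ∨
        (runLengths Sᶜ).count ℓ ≠ 0 → ∃ c, ∀ t, word S t = c := by
      rintro S (h | h)
      · have := (eq_univ_of_count_runLengths hge h).1
        exact ⟨true, fun t => by simp [word, this]⟩
      · have := (eq_univ_of_count_runLengths hge h).1
        rw [compl_eq_univ_iff] at this
        exact ⟨false, fun t => by simp [word, this]⟩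
    have : ((runLengths S).count ℓ ≠ 0 ∨ (runLengths Sᶜ).count ℓ ≠ 0) ∨
        ((runLengths T).count ℓ ≠ 0 ∨ (runLengths Tᶜ).count ℓ ≠ 0) := by omega
    rcases this with h | h
    · exact Or.inl (Or.inr (huniv S h))
    · exact Or.inr (Or.inr (huniv T h))

end Runs

/-! ### From critical coordinates to the influence -/

section Influence

lemma mem_iff_of_inter_card_ne_one {α : Type*} [DecidableEq α] {𝓕 : Finset (Finset α)}
    {F : Finset α} {i : α} (h : (({F, F ∆ {i}} : Finset (Finset α)) ∩ 𝓕).card = 1) :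
    ¬ (F ∈ 𝓕 ↔ F ∆ {i} ∈ 𝓕) := by
  have hne : F ≠ F ∆ {i} := by
    intro e
    have := congrArg (fun G => i ∈ G) e
    simp [mem_symmDiff] at this
  intro hiff
  by_cases hF : F ∈ 𝓕
  · have : ({F, F ∆ {i}} : Finset (Finset α)) ∩ 𝓕 = {F, F ∆ {i}} := by
      rw [inter_eq_left, insert_subset_iff, singleton_subset_iff]
      exact ⟨hF, hiff.1 hF⟩
    rw [this, card_pair hne] at h
    omega
  · have h' : F ∆ {i} ∉ 𝓕 := fun hh => hF (hiff.2 hh)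
    simp [hF, h'] at h

variable {r : ℕ}

lemma influence_half_eq (𝓕 : Finset (Finset (Fin (2 * r + 1)))) (i : Fin (2 * r + 1)) :
    influence (1 / 2) 𝓕 i = (univ.filter fun F : Finset (Fin (2 * r + 1)) =>
      (({F, F ∆ {i}} : Finset (Finset (Fin (2 * r + 1)))) ∩ 𝓕).card = 1).card /
        2 ^ (2 * r + 1) := by
  have hw : ∀ F : Finset (Fin (2 * r + 1)), biasedWeight (1 / 2) F = 1 / 2 ^ (2 * r + 1) := by
    intro F
    have hF : F.card ≤ Fintype.card (Fin (2 * r + 1)) := card_le_univ F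
    unfold biasedWeight
    rw [show (1 - 1 / 2 : ℝ) = 1 / 2 by norm_num, ← pow_add, Nat.add_sub_cancel' hF,
      Fintype.card_fin, one_div_pow]
  rw [influence, biasedMeasure, sum_congr rfl fun F _ => hw F, sum_const, nsmul_eq_mul]
  ring

lemma influence_half_le_one (𝓕 : Finset (Finset (Fin (2 * r + 1)))) (i : Fin (2 * r + 1)) :
    influence (1 / 2) 𝓕 i ≤ 1 := by
  rw [influence_half_eq, div_le_one (by positivity)]
  have := card_le_univ (univ.filter fun F : Finset (Fin (2 * r + 1)) =>
      (({F, F ∆ {i}} : Finset (Finset (Fin (2 * r + 1)))) ∩ 𝓕).card = 1)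
  rw [Fintype.card_finset, Fintype.card_fin] at this
  exact_mod_cast this

lemma word_bijective : Function.Bijective (word (r := r)) := by
  constructor
  · intro S T h
    ext t
    obtain ⟨t, rfl⟩ := (cyc r).surjective t
    rw [← word_eq_true, ← word_eq_true, h]
  · intro x
    refine ⟨univ.filter fun t => x ((cyc r).symm t) = true, ?_⟩
    funext t
    simp [word]

open Classical in
-- The factor 2 arises because criticality holds for the set or for its toggled partner; toggling
-- preserves the uniform measure.
lemma influence_half_family_le (i : ZMod (2 * r + 1)) :
    influence (1 / 2) (family r) (cyc r i) ≤ 2 * (∑ x : ZMod (2 * r + 1) → Bool,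
      (if Critical i x ∨ ∃ c, ∀ t, x t = c then (1 : ℝ) else 0)) / 2 ^ (2 * r + 1) := by
  rw [influence_half_eq]
  refine div_le_div_of_nonneg_right ?_ (by positivity)
  set f : (ZMod (2 * r + 1) → Bool) → ℝ :=
    fun x => if Critical i x ∨ ∃ c, ∀ t, x t = c then 1 else 0 with hf
  have hf0 : ∀ x, 0 ≤ f x := fun x => by simp only [f]; split_ifs <;> simp
  have h1 : ∑ x, f x = ∑ S, f (word S) := (word_bijective.sum_comp f).symm
  have hinv : Function.Involutive fun S : Finset (Fin (2 * r + 1)) => S ∆ {cyc r i} :=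
    fun S => symmDiff_symmDiff_cancel_right _ _
  have h2 : ∑ x, f x = ∑ S : Finset (Fin (2 * r + 1)), f (word (S ∆ {cyc r i})) := by
    rw [h1]; exact (hinv.bijective.sum_comp fun S => f (word S)).symm
  have h3 : 2 * ∑ x, f x = ∑ S, (f (word S) + f (word (S ∆ {cyc r i}))) := by
    rw [sum_add_distrib, ← h1, ← h2, two_mul]
  rw [h3, card_filter, Nat.cast_sum]
  refine sum_le_sum fun S _ => ?_
  split_ifs with h
  · have hST : ∀ t ≠ i, word S t = word (S ∆ {cyc r i}) t := by
      intro t ht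
      simp [word, mem_symmDiff, ht]
    rcases critical_of_mem_family_ne hST (mem_iff_of_inter_card_ne_one h) with h | h
    · have : f (word S) = 1 := by simp only [f]; rw [if_pos h]
      have := hf0 (word (S ∆ {cyc r i}))
      push_cast; linarith
    · have : f (word (S ∆ {cyc r i})) = 1 := by simp only [f]; rw [if_pos h]
      have := hf0 (word S)
      push_cast; linarith
  · push_cast
    exact add_nonneg (hf0 _) (hf0 _)

lemma four_mul_add_le_two_pow {A : ℕ} (hA : 6 ≤ A) : 4 * A + 16 ≤ 2 ^ A := by
  induction A, hA using Nat.le_induction with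
  | base => norm_num
  | succ A hA ih => rw [pow_succ]; omega

lemma influence_half_family_le_log (hr : 32 ≤ r) (i : Fin (2 * r + 1)) :
    influence (1 / 2) (family r) i ≤ 2 ^ 21 * (Real.logb 2 r / r) := by
  classical
  obtain ⟨i, rfl⟩ := (cyc r).surjective i
  set A := Nat.log 2 (2 * r + 1) with hA
  -- Here 2r + 1 ≥ 65 > 2^6, and from A = 6 on 4A + 16 ≤ 2^A, as the probability bound needs.
  have h6 : 6 ≤ A := Nat.le_log_of_pow_le (by norm_num) (by omega)
  have hpow : 2 ^ A ≤ 2 * r + 1 := Nat.pow_log_le_self 2 (by omega)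
  have hlt : 2 * r + 1 < 2 ^ (A + 1) := Nat.lt_pow_succ_log_self (by norm_num) _
  have hsum := sum_critical_le (n := 2 * r + 1) (A := A) (by omega)
    ((four_mul_add_le_two_pow h6).trans hpow) hpow hlt.le i
  have hinf := influence_half_family_le (r := r) i
  have hr0 : (0 : ℝ) < r := by exact_mod_cast (by omega : 0 < r)
  have hAlog : (A : ℝ) ≤ 3 * Real.logb 2 r := by
    have h1 : (A : ℝ) ≤ Real.logb 2 (4 * r) := by
      rw [Real.le_logb_iff_rpow_le (by norm_num) (by positivity), Real.rpow_natCast]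
      have : 2 ^ A ≤ 4 * r := by omega
      exact_mod_cast this
    have h2 : Real.logb 2 (4 * r) = 2 + Real.logb 2 r := by
      rw [Real.logb_mul (by norm_num) hr0.ne', show (4 : ℝ) = 2 ^ (2 : ℝ) by norm_num,
        Real.logb_rpow (by norm_num) (by norm_num)]
    have h3 : 1 ≤ Real.logb 2 r := by
      rw [Real.le_logb_iff_rpow_le (by norm_num) hr0, Real.rpow_one]
      exact_mod_cast (by omega : 2 ≤ r)
    linarith
  calc influence (1 / 2) (family r) (cyc r i)
      ≤ _ := hinf
    _ ≤ 2 * (2 ^ (2 * r + 1) * (2 ^ 19 * (A / ((2 * r + 1 : ℕ) : ℝ)))) / 2 ^ (2 * r + 1) := by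
        gcongr
    _ = 2 ^ 20 * (A / ((2 * r + 1 : ℕ) : ℝ)) := by field_simp
    _ ≤ 2 ^ 20 * (3 * Real.logb 2 r / (2 * r)) := by
        have : (2 * r : ℝ) ≤ ((2 * r + 1 : ℕ) : ℝ) := by push_cast; linarith
        have h0 : 0 ≤ 3 * Real.logb 2 r := le_trans (by positivity) hAlog
        gcongr
    _ ≤ 2 ^ 21 * (Real.logb 2 r / r) := by
        have h0 : 0 ≤ Real.logb 2 r := by
          have : (0 : ℝ) ≤ A := by positivity
          linarith
        have : 0 ≤ Real.logb 2 r / r := by positivity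
        have e : 3 * Real.logb 2 r / (2 * r) = 3 / 2 * (Real.logb 2 r / r) := by
          field_simp
        rw [e]
        linarith

end Influence

end CyclicRuns

theorem lemma6 :
    ∃ C : ℝ, ∀ r : ℕ, 2 ≤ r → ∀ i : Fin (2 * r + 1),
      CyclicRuns.influence (1 / 2) (CyclicRuns.family r) i ≤ C * (Real.logb 2 r / r) := by
  refine ⟨2 ^ 21, fun r hr i => ?_⟩
  rcases le_or_gt 32 r with h | h
  · exact CyclicRuns.influence_half_family_le_log h i
  -- For the finitely many small r the trivial bound 1 suffices, since log₂ r ≥ 1 and r ≤ 32.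
  · refine (CyclicRuns.influence_half_le_one _ i).trans ?_
    have hr0 : (0 : ℝ) < r := by exact_mod_cast (by omega : 0 < r)
    have h3 : 1 ≤ Real.logb 2 r := by
      rw [Real.le_logb_iff_rpow_le (by norm_num) hr0, Real.rpow_one]
      exact_mod_cast hr
    have h4 : (r : ℝ) ≤ 32 := by exact_mod_cast h.le
    rw [← mul_div_assoc, le_div_iff₀ hr0]
    linarith
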